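/- Let $q$ be a prime power and let $F=\mathbb{F}_{q^2}(x,y)$, $x^{q+1}=y^q+y$, be the Hermitian function field over $\mathbb{F}_{q^2}$. Let $Q$ be the pole of $x$, let $P_1,\ldots,P_n$ be all the rational places of $F$ other than $Q$, without repetition, and let $D=P_1+\cdots+P_n$. Then $n=q^3$. For an integer $\mu\ge 0$ let $\mathcal{L}(\mu Q)$ be the Riemann--Roch space of the divisor $\mu Q$, that is, the space of all $f\in F$ with $\nu_Q(f)\ge-\mu$ and $\nu_P(f)\ge 0$ at every place $P\ne Q$, and let $$C_{\mathcal{L}}(D,\mu Q)=\{(f(P_1),\ldots,f(P_n)) \mid f\in\mathcal{L}(\mu Q)\}\subseteq\mathbb{F}_{q^2}^n .$$ For linear codes $C_2\subsetneq C_1\subseteq\mathbb{F}_{q^2}^n$ and $1\le m\le\dim C_1-\dim C_2$, the $m$-th relative generalized Hamming weight is $$M_m(C_1,C_2)=\min\{\#I \mid I\subseteq\{1,\ldots,n\},\ \dim\big((C_1\cap V_I)/(C_2\cap V_I)\big)=m\},$$ where $V_I$ is the set of all words $c\in\mathbb{F}_{q^2}^n$ with $c_i=0$ for every $i\notin I$.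 Let $\mu_1,\mu_2$ be non-negative integers with $1\le\mu_1-\mu_2\le q+1$. For every integer $m$ with $1\le m\le\dim C_{\mathcal{L}}(D,\mu_1Q)-\dim C_{\mathcal{L}}(D,\mu_2Q)$ we have $$M_m\big(C_{\mathcal{L}}(D,\mu_1Q),C_{\mathcal{L}}(D,\mu_2Q)\big)\ \ge\ n-\mu_1+\sum_{s=0}^{m-2}(q-s)\ =\ n-\mu_1+q(m-1)-\frac{(m-2)(m-1)}{2}. \qquad (*)$$ If moreover $c-1\le\mu_2$ and $\mu_1<n-c$, where $c=q(q-1)$, then $$\dim C_{\mathcal{L}}(D,\mu_1Q)-\dim C_{\mathcal{L}}(D,\mu_2Q)=\mu_1-\mu_2,$$ and equality holds in $(*)$ for every such $m$. -/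

import Mathlib

noncomputable section

namespace Hermitian

open Polynomial

/-! ### Relative generalized Hamming weights -/

/-- `V_I`: the words of `K ^ ι` that vanish outside `I`. -/
def supportedOn (K : Type*) [Field K] {ι : Type*} (I : Finset ι) : Submodule K (ι → K) where
  carrier := {c | ∀ i, i ∉ I → c i = 0}
  zero_mem' := fun _ _ => rfl
  add_mem' := fun {a b} ha hb i hi => by simp [ha i hi, hb i hi]
  smul_mem' := fun r a ha i hi => by simp [ha i hi]

/-- `dim ((C₁ ∩ V_I) / (C₂ ∩ V_I))`. -/
def relDim {K : Type*} [Field K] {ι : Type*} (C₁ C₂ : Submodule K (ι → K)) (I : Finset ι) : ℕ :=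
  Module.finrank K
    (↥(C₁ ⊓ supportedOn K I) ⧸ (C₂ ⊓ supportedOn K I).submoduleOf (C₁ ⊓ supportedOn K I))

/-- The `m`-th relative generalized Hamming weight of `C₂ ⊆ C₁ ⊆ K ^ ι`: the smallest size of a
set `I` of coordinates with `dim ((C₁ ∩ V_I) / (C₂ ∩ V_I)) = m`. -/
def rghw {K : Type*} [Field K] {ι : Type*} (C₁ C₂ : Submodule K (ι → K)) (m : ℕ) : ℕ :=
  sInf {k : ℕ | ∃ I : Finset ι, I.card = k ∧ relDim C₁ C₂ I = m}

/-! ### Places, Riemann-Roch spaces and algebraic geometric codes -/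

/-- A place of a function field `F / K`, given by its normalized discrete valuation. The valuation
is written multiplicatively: `v f = exp (-ν f)` where `ν : F → ℤ ∪ {∞}` is the additive one. -/
@[ext] structure Place (K F : Type*) [Field K] [Field F] [Algebra K F] where
  v : Valuation F (WithZero (Multiplicative ℤ))
  map_algebraMap : ∀ a : K, a ≠ 0 → v (algebraMap K F a) = 1
  surjective : Function.Surjective v

section

variable {K F : Type*} [Field K] [Field F] [Algebra K F]

theorem Place.map_algebraMap_le (P : Place K F) (a : K) : P.v (algebraMap K F a) ≤ 1 := by
  by_cases h : a = 0
  · simp [h]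
  · exact (P.map_algebraMap a h).le

/-- A place is rational if it has degree one, that is, if its residue field is `K`. -/
def Place.IsRational (P : Place K F) : Prop :=
  ∀ f : F, P.v f ≤ 1 → ∃ a : K, P.v (f - algebraMap K F a) < 1

/-- `P` is a pole of `f`. -/
def Place.IsPole (P : Place K F) (f : F) : Prop := 1 < P.v f

/-- `f(P) = a`: the function `f` is regular at `P` and its residue class at `P` is `a`.
If `P` is rational and `f` is regular at `P`, there is exactly one such `a`. -/
def Place.HasValue (P : Place K F) (f : F) (a : K) : Prop :=
  P.v (f - algebraMap K F a) < 1

/-- The Riemann-Roch space `L(G) = {f | ν_P(f) ≥ -G(P) for all places P}` of a divisor `G`. -/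
def riemannRochSpace (G : Place K F →₀ ℤ) : Submodule K F where
  carrier := {f | ∀ P : Place K F, P.v f ≤ WithZero.exp (G P)}
  zero_mem' := fun P => by simp
  add_mem' := fun {f g} hf hg P => (P.v.map_add f g).trans (max_le (hf P) (hg P))
  smul_mem' := fun a f hf P => by
    rw [Algebra.smul_def, map_mul]
    exact (mul_le_of_le_one_left' (P.map_algebraMap_le a)).trans (hf P)

/-- The code `C_L(D, G) = {(f(P_1), …, f(P_n)) | f ∈ L(G)}`, where `D = P_1 + ⋯ + P_n`. -/
def agCode {ι : Type*} (P : ι → Place K F) (G : Place K F →₀ ℤ) : Submodule K (ι → K) where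
  carrier := {c | ∃ f ∈ riemannRochSpace G, ∀ i, (P i).HasValue f (c i)}
  zero_mem' := ⟨0, zero_mem _, fun i => by simp [Place.HasValue]⟩
  add_mem' := by
    rintro a b ⟨f, hf, hfa⟩ ⟨g, hg, hgb⟩
    refine ⟨f + g, add_mem hf hg, fun i => ?_⟩
    have h := (P i).v.map_add_lt (hfa i) (hgb i)
    simpa [Place.HasValue, add_sub_add_comm] using h
  smul_mem' := by
    rintro r a ⟨f, hf, hfa⟩
    refine ⟨r • f, Submodule.smul_mem _ r hf, fun i => ?_⟩
    have h : r • f - algebraMap K F ((r • a) i)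
        = algebraMap K F r * (f - algebraMap K F (a i)) := by
      simp [Algebra.smul_def, mul_sub]
    rw [Place.HasValue, h, map_mul]
    exact (mul_le_of_le_one_left' ((P i).map_algebraMap_le r)).trans_lt (hfa i)

end

/-! ### The Hermitian function field -/

/-- The Hermitian polynomial `x ^ (q + 1) - y ^ q - y`, as a polynomial in `x` over `K[y]`. -/
def hermitianPoly (K : Type*) [Field K] (q : ℕ) : K[X][X] :=
  X ^ (q + 1) - C (X ^ q + X)

theorem irreducible_hermitianPoly (K : Type*) [Field K] {q : ℕ} (hq : 2 ≤ q) :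
    Irreducible (hermitianPoly K q) := by
  have hdeg : (hermitianPoly K q).degree = ((q + 1 : ℕ) : WithBot ℕ) :=
    degree_X_pow_sub_C (Nat.succ_pos q) _
  have hmon : (hermitianPoly K q).Monic := monic_X_pow_sub_C _ (Nat.succ_ne_zero q)
  have hprime : (Ideal.span {(X : K[X])}).IsPrime :=
    (Ideal.span_singleton_prime X_ne_zero).2 prime_X
  refine irreducible_of_eisenstein_criterion hprime ?_ ?_ ?_ ?_ hmon.isPrimitive
  · rw [hmon.leadingCoeff, Ideal.mem_span_singleton]
    exact fun h => not_isUnit_X (isUnit_of_dvd_one h)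
  · intro n hn
    rw [hdeg, Nat.cast_lt] at hn
    rw [Ideal.mem_span_singleton, hermitianPoly, coeff_sub, coeff_X_pow, coeff_C, if_neg hn.ne]
    split_ifs
    · rw [zero_sub, dvd_neg]
      exact dvd_add (dvd_pow_self _ (by omega)) dvd_rfl
    · simp
  · rw [hdeg]
    exact_mod_cast Nat.succ_pos q
  · rw [Ideal.span_singleton_pow, Ideal.mem_span_singleton, X_pow_dvd_iff]
    intro h
    have h1 := h 1 (by norm_num)
    rw [hermitianPoly, coeff_sub, coeff_X_pow, coeff_C_zero, if_neg (by omega)] at h1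
    have hq1 : ¬ (1 = q) := by omega
    simp [coeff_X_pow, hq1] at h1

/-- The affine coordinate ring `K[x, y] / (x ^ (q + 1) - y ^ q - y)`. -/
abbrev CoordinateRing (K : Type*) [Field K] (q : ℕ) : Type _ :=
  AdjoinRoot (hermitianPoly K q)

instance (K : Type*) [Field K] (q : ℕ) [hq : Fact (IsPrimePow q)] :
    IsDomain (CoordinateRing K q) :=
  AdjoinRoot.isDomain_of_prime (irreducible_hermitianPoly K hq.out.two_le).prime

/-- The Hermitian function field `K(x, y)`, `x ^ (q + 1) = y ^ q + y`. -/
abbrev FunctionField (K : Type*) [Field K] (q : ℕ) [Fact (IsPrimePow q)] : Type _ :=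
  FractionRing (CoordinateRing K q)

/-- The function `x` on the Hermitian curve. -/
def funX (K : Type*) [Field K] (q : ℕ) [Fact (IsPrimePow q)] : FunctionField K q :=
  algebraMap (CoordinateRing K q) (FunctionField K q) (AdjoinRoot.root (hermitianPoly K q))

/-- The one-point Hermitian code `C_L(P_1 + ⋯ + P_n, μ Q)`. -/
def code {K : Type*} [Field K] {q : ℕ} [Fact (IsPrimePow q)] {n : ℕ}
    (P : Fin n → Place K (FunctionField K q)) (Q : Place K (FunctionField K q)) (μ : ℕ) :
    Submodule K (Fin n → K) :=
  agCode P (Finsupp.single Q (μ : ℤ))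

end Hermitian

end

noncomputable section

namespace Hermitian

open Polynomial IsDedekindDomain

/-! ### Trace and norm from the field with q^2 elements, and the count of affine points -/

section FiniteField

variable {K : Type*} {q : ℕ}

/-! Away from Q the problem is polynomial. The ring R = K[x,y]/(x^(q+1) - y^q - y) is Dedekind, so
L(μQ) consists of the elements of R of pole order at most μ, and the rational places other than Q
are the q^3 affine points. The monomials x^i y^j with i ≤ q span R and have distinct pole orders qi
+ (q+1)j. Hence the pole orders form the semigroup H generated by q and q+1, and each order comes
from a single leading monomial (`exists_leading_term`).

Lower bound. If I has relative dimension m, there are m functions vanishing outside I whose pole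
orders form an m-element set Γ in (μ₂, μ₁] (`exists_vanishing_of_relDim`). Their common zeros number
at most #(H \ (Γ + H)) (`card_common_zeros_le`). For g = max Γ, the set H \ (g + H) has at most g
elements. The other members of Γ lie within q of g, and together they remove at least the sum of q -
s over s < m - 1 from it (`footprint_bound`).

Upper bound. Above the conductor, μ₁, …, μ₁ - m + 1 are weights of monomials. Replacing powers of x
and y by products of factors x - a_l and y - b_w keeps the pole orders and makes these functions
vanish on a set of points shaped like the staircase below the exponents. Such sets exist because the
q+1 fibres over x^(q+1) = 1 share the same q values of y, while the other columns are full fibres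
(`exists_zero_set`). `exists_staircase` makes the set large enough. Evaluation kills no function of
pole order below n, so the complement of the set has relative dimension at least m (`le_relDim`). -/

theorem finite_of_natCard_eq_sq (hq : IsPrimePow q) (hK : Nat.card K = q ^ 2) : Finite K :=
  Nat.finite_of_card_ne_zero (by rw [hK]; exact pow_ne_zero _ hq.pos.ne')

variable [Field K]

theorem exists_char_of_natCard_eq_sq (hq : IsPrimePow q) (hK : Nat.card K = q ^ 2) :
    ∃ p e : ℕ, p.Prime ∧ CharP K p ∧ e ≠ 0 ∧ q = p ^ e := by
  have := finite_of_natCard_eq_sq hq hK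
  have := Fintype.ofFinite K
  obtain ⟨p, e, hp, he, rfl⟩ := hq
  obtain ⟨r, hr⟩ := CharP.exists K
  obtain ⟨n, hr', hn⟩ := FiniteField.card K r
  rw [← Nat.card_eq_fintype_card, hK, ← pow_mul] at hn
  have hpr : p ∣ r ^ (n : ℕ) := hn ▸ dvd_pow_self p (by omega)
  have h : p = r := (Nat.prime_dvd_prime_iff_eq hp.nat_prime hr').1 (hp.nat_prime.dvd_of_dvd_pow hpr)
  exact ⟨p, e, hp.nat_prime, h ▸ hr, he.ne', rfl⟩

theorem add_pow_of_natCard_eq_sq (hq : IsPrimePow q) (hK : Nat.card K = q ^ 2) (a b : K) :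
    (a + b) ^ q = a ^ q + b ^ q := by
  obtain ⟨p, e, hp, hc, -, rfl⟩ := exists_char_of_natCard_eq_sq hq hK
  have := Fact.mk hp
  exact add_pow_char_pow a b p e

theorem natCast_eq_zero_of_natCard_eq_sq (hq : IsPrimePow q) (hK : Nat.card K = q ^ 2) :
    (q : K) = 0 := by
  obtain ⟨p, e, hp, hc, he, rfl⟩ := exists_char_of_natCard_eq_sq hq hK
  simp [he]

theorem pow_pow_of_natCard_eq_sq (hq : IsPrimePow q) (hK : Nat.card K = q ^ 2) (a : K) :
    (a ^ q) ^ q = a := by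
  have := finite_of_natCard_eq_sq hq hK
  have := Fintype.ofFinite K
  rw [← pow_mul, ← sq, ← hK, Nat.card_eq_fintype_card, FiniteField.pow_card]

/-- The trace `b ↦ b ^ q + b` of the quadratic extension, as an additive map. -/
def traceHom (hq : IsPrimePow q) (hK : Nat.card K = q ^ 2) : K →+ K where
  toFun b := b ^ q + b
  map_zero' := by simp [hq.pos.ne']
  map_add' a b := by rw [add_pow_of_natCard_eq_sq hq hK]; ring

theorem ncard_setOf_isRoot_le {f : K[X]} (hf : f ≠ 0) : {b : K | f.IsRoot b}.ncard ≤ f.natDegree := by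
  classical
  have h : {b : K | f.IsRoot b} = (f.roots.toFinset : Set K) := by
    ext b; simp [hf]
  rw [h, Set.ncard_coe_finset]
  exact (Multiset.toFinset_card_le _).trans (card_roots' f)

/-- The kernel lies among the roots of X^q + X and the range among those of X^q - X, so each has at
most q elements. Their orders multiply to q^2, so both bounds are attained. -/
theorem natCard_ker_and_range_traceHom (hq : IsPrimePow q) (hK : Nat.card K = q ^ 2) :
    Nat.card (traceHom hq hK).ker = q ∧ {c : K | c ^ q = c} ⊆ (traceHom hq hK).range := by
  have hfin := finite_of_natCard_eq_sq hq hK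
  have hq2 := hq.two_le
  have hd1 : (X ^ q + X : K[X]).natDegree = q := by
    rw [natDegree_add_eq_left_of_natDegree_lt] <;> simp; omega
  have hd2 : (X ^ q - X : K[X]).natDegree = q := by
    rw [natDegree_sub_eq_left_of_natDegree_lt] <;> simp; omega
  have h1 : Nat.card (traceHom hq hK).ker ≤ q := by
    have h := ncard_setOf_isRoot_le (f := (X ^ q + X : K[X])) (by
      intro h; rw [h] at hd1; simp at hd1; omega)
    rw [hd1, ← Nat.card_coe_set_eq] at h
    convert h using 3
    simp [traceHom, AddMonoidHom.mem_ker, IsRoot]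
  have h2 : {c : K | c ^ q = c}.ncard ≤ q := by
    have h := ncard_setOf_isRoot_le (f := (X ^ q - X : K[X])) (by
      intro h; rw [h] at hd2; simp at hd2; omega)
    rw [hd2] at h
    convert h using 3
    simp [IsRoot, sub_eq_zero]
  have h3 : ((traceHom hq hK).range : Set K) ⊆ {c : K | c ^ q = c} := by
    rintro _ ⟨b, rfl⟩
    change (b ^ q + b) ^ q = b ^ q + b
    rw [add_pow_of_natCard_eq_sq hq hK, pow_pow_of_natCard_eq_sq hq hK, add_comm]
  have h4 : Nat.card (traceHom hq hK).range ≤ {c : K | c ^ q = c}.ncard := by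
    rw [← Nat.card_coe_set_eq]
    exact Nat.card_le_card_of_injective _ (Set.inclusion_injective h3)
  have h5 : Nat.card (traceHom hq hK).range * Nat.card (traceHom hq hK).ker = q ^ 2 := by
    rw [← hK, AddSubgroup.card_eq_card_quotient_mul_card_addSubgroup (traceHom hq hK).ker,
      Nat.card_congr (QuotientAddGroup.quotientKerEquivRange (traceHom hq hK)).toEquiv]
  have h6 : Nat.card (traceHom hq hK).ker = q := by nlinarith [hq.pos]
  refine ⟨h6, ?_⟩
  rw [h6] at h5
  have h7 : Nat.card (traceHom hq hK).range = q := by nlinarith [hq.pos]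
  refine (Set.eq_of_subset_of_ncard_le h3 ?_).ge
  rw [← Nat.card_coe_set_eq (((traceHom hq hK).range : AddSubgroup K) : Set K)]
  exact h2.trans h7.ge

/-- Every element of the subfield with `q` elements is a trace in exactly `q` ways. -/
theorem ncard_trace_fiber (hq : IsPrimePow q) (hK : Nat.card K = q ^ 2) {c : K} (hc : c ^ q = c) :
    {b : K | b ^ q + b = c}.ncard = q := by
  obtain ⟨h1, h2⟩ := natCard_ker_and_range_traceHom hq hK
  obtain ⟨b₀, hb₀⟩ := h2 hc
  have h : {b : K | b ^ q + b = c} = (b₀ + ·) '' ((traceHom hq hK).ker : Set K) := by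
    ext b
    constructor
    · intro hb
      refine ⟨b - b₀, ?_, by simp⟩
      change traceHom hq hK (b - b₀) = 0
      rw [map_sub, hb₀]
      exact sub_eq_zero.2 hb
    · rintro ⟨d, hd, rfl⟩
      change traceHom hq hK (b₀ + d) = c
      rw [map_add, hb₀, show traceHom hq hK d = 0 from hd, add_zero]
  rw [h, Set.ncard_image_of_injective _ (add_right_injective b₀), ← Nat.card_coe_set_eq]
  exact h1

theorem norm_pow_of_natCard_eq_sq (hq : IsPrimePow q) (hK : Nat.card K = q ^ 2) (a : K) :
    (a ^ (q + 1)) ^ q = a ^ (q + 1) := by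
  rw [← pow_mul, mul_comm, pow_mul, pow_succ, pow_pow_of_natCard_eq_sq hq hK, ← pow_succ']

/-- The affine points of the Hermitian curve. -/
def affinePoints (K : Type*) [Field K] (q : ℕ) : Set (K × K) :=
  {z | z.1 ^ (q + 1) = z.2 ^ q + z.2}

theorem ncard_affinePoints (hq : IsPrimePow q) (hK : Nat.card K = q ^ 2) :
    (affinePoints K q).ncard = q ^ 3 := by
  have hfin := finite_of_natCard_eq_sq hq hK
  have := Fintype.ofFinite K
  let e : affinePoints K q ≃ Σ a : K, {b : K | b ^ q + b = a ^ (q + 1)} :=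
    { toFun := fun z => ⟨z.1.1, z.1.2, z.2.symm⟩
      invFun := fun z => ⟨(z.1, z.2.1), z.2.2.symm⟩
      left_inv := fun z => rfl
      right_inv := fun z => rfl }
  rw [← Nat.card_coe_set_eq, Nat.card_congr e, Nat.card_sigma]
  simp_rw [Nat.card_coe_set_eq, ncard_trace_fiber hq hK (norm_pow_of_natCard_eq_sq hq hK _)]
  simp [← Nat.card_eq_fintype_card, hK]
  ring

/-- The powers of g^(q-1), for g a generator of the cyclic unit group of order (q-1)(q+1). -/
theorem exists_injOn_norm_eq_one (hq : IsPrimePow q) (hK : Nat.card K = q ^ 2) :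
    ∃ a : ℕ → K, Set.InjOn a (Set.Iio (q + 1)) ∧ ∀ i, a i ^ (q + 1) = 1 := by
  have hfin := finite_of_natCard_eq_sq hq hK
  have hq2 := hq.two_le
  obtain ⟨g, hg⟩ := IsCyclic.exists_ofOrder_eq_natCard (α := Kˣ)
  rw [Nat.card_units, hK] at hg
  have hfac : q ^ 2 - 1 = (q - 1) * (q + 1) := by
    obtain ⟨r, rfl⟩ : ∃ r, q = r + 1 := ⟨q - 1, by omega⟩
    rw [Nat.add_sub_cancel]
    apply Nat.sub_eq_of_eq_add; ring
  have ho : orderOf (g ^ (q - 1)) = q + 1 := by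
    rw [orderOf_pow_of_dvd (by omega) (by rw [hg, hfac]; exact dvd_mul_right _ _), hg, hfac,
      Nat.mul_div_cancel_left _ (by omega)]
  refine ⟨fun i => ((g ^ (q - 1)) ^ i : Kˣ), ?_, fun i => ?_⟩
  · intro i hi j hj h
    refine pow_injOn_Iio_orderOf (x := g ^ (q - 1)) ?_ ?_ (Units.ext h) <;> rw [ho] <;> assumption
  · rw [← Units.val_pow_eq_pow_val, ← pow_mul, mul_comm, pow_mul]
    rw [orderOf_dvd_iff_pow_eq_one.1 ho.dvd, one_pow, Units.val_one]

end FiniteField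

/-! ### A Dedekind criterion by vanishing differentials -/

section Unramified

/-- A domain generated over a Dedekind domain by a root of the separable polynomial `T ^ q + T - z`
is a Dedekind domain. -/
theorem isDedekindDomain_of_ringHom {R B : Type*} [CommRing R] [IsDedekindDomain R]
    [CommRing B] [IsDomain B] (φ : R →+* B) (y : B)
    (hy : ∀ S : Subring B, (∀ r, φ r ∈ S) → y ∈ S → S = ⊤) (q : ℕ) (hq : 1 < q)
    (hqB : (q : B) = 0) (z : R) (hyz : y ^ q + y = φ z) : IsDedekindDomain B := by
  let := φ.toAlgebra
  replace hyz : y ^ q + y = algebraMap R B z := hyz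
  replace hy : Algebra.adjoin R {y} = ⊤ := by
    have h := hy (Algebra.adjoin R {y}).toSubring (fun r => Subalgebra.algebraMap_mem _ r)
      (Algebra.subset_adjoin rfl)
    rw [eq_top_iff]
    rintro b -
    have hb : b ∈ (Algebra.adjoin R {y}).toSubring := by rw [h]; trivial
    exact hb
  have hint : IsIntegral R y := by
    refine ⟨X ^ q + (X - C z), ?_, ?_⟩
    · apply monic_X_pow_add
      rw [degree_X_sub_C]
      exact_mod_cast hq
    · rw [← aeval_def]
      simp [← hyz]
  have : Module.Finite R B := by
    rw [Module.finite_def, ← Algebra.top_toSubmodule, ← hy]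
    exact hint.fg_adjoin_singleton
  -- Differentiating y^q + y = z over R gives q y^(q-1) dy + dy = 0, and q = 0 in B, so dy = 0.
  have hD : KaehlerDifferential.D R B = 0 := by
    refine Derivation.ext_of_adjoin_eq_top {y} hy ?_
    rintro _ rfl
    have h := congr_arg (KaehlerDifferential.D R B) hyz
    rw [map_add, Derivation.leibniz_pow, Derivation.map_algebraMap, ← Nat.cast_smul_eq_nsmul B, hqB,
      zero_smul, zero_add] at h
    simpa using h
  have : Algebra.FormallyUnramified R B := by
    constructor
    rw [← Submodule.subsingleton_iff B]
    rw [← subsingleton_iff_bot_eq_top, ← KaehlerDifferential.span_range_derivation, hD]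
    symm
    rw [Submodule.span_eq_bot]
    rintro _ ⟨_, rfl⟩
    rfl
  exact isDedekindDomain.of_formallyUnramified R B

end Unramified

/-! ### The coordinate ring and its monomials -/

section CoordinateRing

variable (K : Type*) [Field K] (q : ℕ)

/-- The function `x` in the coordinate ring. -/
def coordX : CoordinateRing K q := AdjoinRoot.root (hermitianPoly K q)

/-- The function `y` in the coordinate ring. -/
def coordY : CoordinateRing K q := AdjoinRoot.of (hermitianPoly K q) X

theorem coordX_pow : coordX K q ^ (q + 1) = coordY K q ^ q + coordY K q := by
  have h : AdjoinRoot.mk (hermitianPoly K q) (X ^ (q + 1) - C (X ^ q + X)) = 0 :=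
    AdjoinRoot.mk_self (f := hermitianPoly K q)
  rw [map_sub, map_pow, AdjoinRoot.mk_X, AdjoinRoot.mk_C, map_add, map_pow, sub_eq_zero] at h
  exact h

variable {K q}

theorem algebraMap_coordinateRing (a : K) :
    algebraMap K (CoordinateRing K q) a = AdjoinRoot.of (hermitianPoly K q) (C a) := rfl

/-- Evaluation at an affine point of the Hermitian curve. -/
def evalHom (z : affinePoints K q) : CoordinateRing K q →ₐ[K] K :=
  AdjoinRoot.liftAlgHom (hermitianPoly K q) (aeval z.1.2) z.1.1 (by
    have h : z.1.1 ^ (q + 1) = z.1.2 ^ q + z.1.2 := z.2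
    rw [hermitianPoly, eval₂_sub, eval₂_X_pow, eval₂_C, h]; simp)

@[simp] theorem evalHom_coordX (z : affinePoints K q) : evalHom z (coordX K q) = z.1.1 :=
  AdjoinRoot.liftAlgHom_root ..

@[simp] theorem evalHom_coordY (z : affinePoints K q) : evalHom z (coordY K q) = z.1.2 :=
  (AdjoinRoot.liftAlgHom_of ..).trans (aeval_X _)

/-- The monomial `x ^ i * y ^ j`. -/
def monom (K : Type*) [Field K] (q : ℕ) (z : ℕ × ℕ) : CoordinateRing K q :=
  coordX K q ^ z.1 * coordY K q ^ z.2

/-- Division by the Hermitian polynomial, monic of degree q + 1 in x, leaves x-degree at most q. -/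
theorem span_monom_eq_top : Submodule.span K (monom K q '' {z | z.1 ≤ q}) = ⊤ := by
  rw [eq_top_iff]
  rintro f -
  have hmon : (hermitianPoly K q).Monic := monic_X_pow_sub_C _ (Nat.succ_ne_zero q)
  have hdeg : (hermitianPoly K q).natDegree = q + 1 := natDegree_X_pow_sub_C
  obtain ⟨p, hp, rfl⟩ : ∃ p : K[X][X], p.natDegree < q + 1 ∧ AdjoinRoot.mk (hermitianPoly K q) p = f := by
    obtain ⟨p, rfl⟩ := AdjoinRoot.mk_surjective f
    refine ⟨p %ₘ hermitianPoly K q, ?_, ?_⟩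
    · rw [← hdeg]
      exact natDegree_modByMonic_lt _ hmon (fun h => by rw [h] at hdeg; simp at hdeg)
    · rw [AdjoinRoot.mk_eq_mk, modByMonic_eq_sub_mul_div]
      exact ⟨-(p /ₘ hermitianPoly K q), by ring⟩
  rw [p.as_sum_range_C_mul_X_pow' hp, map_sum]
  refine Submodule.sum_mem _ fun i hi => ?_
  rw [map_mul, map_pow, AdjoinRoot.mk_X, AdjoinRoot.mk_C, (p.coeff i).as_sum_range_C_mul_X_pow, map_sum,
    Finset.sum_mul]
  refine Submodule.sum_mem _ fun j _ => ?_
  have h : AdjoinRoot.of (hermitianPoly K q) (C ((p.coeff i).coeff j) * X ^ j) *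
      AdjoinRoot.root (hermitianPoly K q) ^ i = (p.coeff i).coeff j • monom K q (i, j) := by
    rw [Algebra.smul_def, map_mul, map_pow, algebraMap_coordinateRing, monom, coordX, coordY]
    ring
  rw [h]
  exact Submodule.smul_mem _ _ (Submodule.subset_span ⟨(i, j), by simpa [Nat.lt_succ_iff] using hi, rfl⟩)

theorem exists_expansion (f : CoordinateRing K q) :
    ∃ c : ℕ × ℕ →₀ K, (∀ z ∈ c.support, z.1 ≤ q) ∧ f = ∑ z ∈ c.support, c z • monom K q z := by
  have hf : f ∈ Submodule.span K (monom K q '' {z | z.1 ≤ q}) := by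
    rw [span_monom_eq_top]; trivial
  obtain ⟨c, hc, rfl⟩ := (Finsupp.mem_span_image_iff_linearCombination K).1 hf
  exact ⟨c, fun z hz => hc hz, rfl⟩

theorem adjoin_coord_eq_top : Algebra.adjoin K {coordX K q, coordY K q} = ⊤ := by
  rw [eq_top_iff]
  rintro f -
  obtain ⟨c, -, rfl⟩ := exists_expansion f
  refine sum_mem fun z _ => Subalgebra.smul_mem _ (mul_mem (pow_mem ?_ _) (pow_mem ?_ _)) _ <;>
  exact Algebra.subset_adjoin (by simp)

theorem isDedekindDomain_coordinateRing [hq : Fact (IsPrimePow q)] (hqK : (q : K) = 0) :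
    IsDedekindDomain (CoordinateRing K q) := by
  let φ : K[X] →ₐ[K] CoordinateRing K q := aeval (coordX K q)
  have hφX : φ X = coordX K q := aeval_X _
  refine isDedekindDomain_of_ringHom φ.toRingHom (coordY K q) (fun S hS hy => ?_) q
    hq.out.one_lt ?_ (X ^ (q + 1)) ?_
  · rw [eq_top_iff]
    rintro f -
    obtain ⟨c, -, rfl⟩ := exists_expansion f
    refine sum_mem fun z _ => ?_
    rw [Algebra.smul_def, monom, ← φ.commutes, ← hφX]
    exact mul_mem (hS _) (mul_mem (pow_mem (hS _) _) (pow_mem hy _))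
  · rw [← map_natCast (algebraMap K (CoordinateRing K q)), hqK, map_zero]
  · rw [← coordX_pow, ← hφX, ← map_pow]
    rfl

end CoordinateRing

/-- The weight of `x ^ i * y ^ j`, that is, its pole order at infinity. -/
def weight (q : ℕ) (z : ℕ × ℕ) : ℕ := q * z.1 + (q + 1) * z.2

theorem weight_add (q : ℕ) (z w : ℕ × ℕ) : weight q (z + w) = weight q z + weight q w := by
  simp [weight]; ring

/-- Modulo q + 1 the weight is -i, which determines i in the range 0 ≤ i ≤ q. -/
theorem weight_injOn (q : ℕ) : Set.InjOn (weight q) {z | z.1 ≤ q} := by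
  rintro ⟨i, j⟩ (hi : i ≤ q) ⟨i', j'⟩ (hi' : i' ≤ q) h
  simp only [weight] at h
  have h1 : i = i' := by
    have h2 : ((q : ℤ) + 1) ∣ (i : ℤ) - i' := by
      refine ⟨i + j - i' - j', ?_⟩
      have : (q * i + (q + 1) * j : ℤ) = q * i' + (q + 1) * j' := by exact_mod_cast h
      linarith
    have h3 := Int.eq_zero_of_abs_lt_dvd h2 (by rw [abs_lt]; constructor <;> omega)
    omega
  subst h1
  have : j = j' := by nlinarith [Nat.eq_of_mul_eq_mul_left (Nat.succ_pos q) (by omega : (q + 1) * j = (q + 1) * j')]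
  rw [this]

/-! ### Pole orders at infinity and uniqueness of the pole of x -/

section Places

variable {K : Type*} [Field K] {q : ℕ} [hq : Fact (IsPrimePow q)]

/-- The image of a regular function in the function field. -/
abbrev toFF (f : CoordinateRing K q) : FunctionField K q :=
  algebraMap (CoordinateRing K q) (FunctionField K q) f

theorem toFF_algebraMap (a : K) :
    toFF (algebraMap K (CoordinateRing K q) a) = algebraMap K (FunctionField K q) a :=
  (IsScalarTower.algebraMap_apply K (CoordinateRing K q) (FunctionField K q) a).symm

/-- A pole of y would be a pole of y^q + y = x^(q+1), since y^q dominates y there. -/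
theorem Place.toFF_le_one_of_not_isPole (R : Place K (FunctionField K q))
    (hR : ¬ R.IsPole (funX K q)) (f : CoordinateRing K q) : R.v (toFF f) ≤ 1 := by
  have hx : R.v (toFF (coordX K q)) ≤ 1 := not_lt.1 hR
  have hy : R.v (toFF (coordY K q)) ≤ 1 := by
    by_contra! hy
    have h := congr_arg (fun f => R.v (toFF f)) (coordX_pow K q)
    simp only [toFF, map_pow, map_add] at h
    rw [Valuation.map_add_eq_of_lt_left, map_pow] at h
    · have h1 := one_lt_pow₀ hy hq.out.pos.ne'
      rw [← h] at h1
      exact h1.not_ge (pow_le_one₀ zero_le hx)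
    · rw [map_pow]
      exact lt_self_pow₀ hy hq.out.one_lt
  have hf : f ∈ Algebra.adjoin K {coordX K q, coordY K q} := by
    rw [adjoin_coord_eq_top]; trivial
  induction hf using Algebra.adjoin_induction with
  | mem x hx' =>
    rcases hx' with rfl | rfl
    · exact hx
    · exact hy
  | algebraMap r => rw [toFF_algebraMap]; exact R.map_algebraMap_le r
  | add x y _ _ h1 h2 => rw [toFF, map_add]; exact (R.v.map_add _ _).trans (max_le h1 h2)
  | mul x y _ _ h1 h2 => rw [toFF, map_mul, map_mul]; exact mul_le_one' h1 h2

/-- At a pole, v(x)^(q+1) = v(y)^q. Hence t = v(y)/v(x) satisfies t^q = v(x) and t^(q+1) = v(y). -/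
theorem Place.exists_pole_order (R : Place K (FunctionField K q)) (hR : R.IsPole (funX K q)) :
    ∃ t : WithZero (Multiplicative ℤ), 1 < t ∧ ∀ z, R.v (toFF (monom K q z)) = t ^ weight q z := by
  have hx : 1 < R.v (toFF (coordX K q)) := hR
  have h := congr_arg (fun f => R.v (toFF f)) (coordX_pow K q)
  simp only [toFF, map_pow, map_add] at h
  have hy : 1 < R.v (toFF (coordY K q)) := by
    by_contra! hy
    have h1 := one_lt_pow₀ hx (Nat.succ_ne_zero q)
    rw [h] at h1
    refine h1.not_ge ((R.v.map_add _ _).trans (max_le ?_ hy))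
    rw [map_pow]
    exact pow_le_one₀ zero_le hy
  rw [Valuation.map_add_eq_of_lt_left, map_pow] at h
  swap
  · rw [map_pow]
    exact lt_self_pow₀ hy hq.out.one_lt
  set a := R.v (toFF (coordX K q)) with ha
  set b := R.v (toFF (coordY K q)) with hb
  have ha0 : a ≠ 0 := (zero_lt_one.trans hx).ne'
  have h1 : (b / a) ^ q = a := by
    rw [div_pow, ← h, pow_succ, mul_div_cancel_left₀ _ (pow_ne_zero _ ha0)]
  have h2 : (b / a) ^ (q + 1) = b := by
    rw [pow_succ, h1, mul_div_cancel₀ _ ha0]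
  refine ⟨b / a, ?_, fun z => ?_⟩
  · by_contra! hba
    exact hx.not_ge (h1 ▸ pow_le_one₀ zero_le hba)
  · rw [monom, toFF, map_mul, map_pow, map_pow, map_mul, map_pow, map_pow, weight, pow_add, pow_mul, pow_mul,
      h1, h2]

/-- Distinct weights make the term of largest weight dominate. The base t is left free because its
value `exp 1` is only derived from this lemma, and z and c are chosen before R so that different
poles can be compared. -/
theorem exists_leading_term_aux (f : CoordinateRing K q) (hf : f ≠ 0) :
    ∃ z : ℕ × ℕ, z.1 ≤ q ∧ ∃ c : K, c ≠ 0 ∧ ∀ (R : Place K (FunctionField K q))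
      (t : WithZero (Multiplicative ℤ)), 1 < t → (∀ z, R.v (toFF (monom K q z)) = t ^ weight q z) →
      R.v (toFF (f - c • monom K q z)) < t ^ weight q z := by
  obtain ⟨c, hc, rfl⟩ := exists_expansion f
  have hne : c.support.Nonempty := by
    rw [Finset.nonempty_iff_ne_empty]
    intro h
    simp [h] at hf
  obtain ⟨z, hz, hmax⟩ := c.support.exists_max_image (weight q) hne
  refine ⟨z, hc z hz, c z, Finsupp.mem_support_iff.1 hz, fun R t ht hR => ?_⟩
  rw [← Finset.add_sum_erase _ _ hz, add_sub_cancel_left, toFF, map_sum]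
  have ht0 : t ≠ 0 := (zero_lt_one.trans ht).ne'
  refine R.v.map_sum_lt (pow_ne_zero _ ht0) fun w hw => ?_
  have hw' := Finset.mem_of_mem_erase hw
  rw [Algebra.smul_def, map_mul, map_mul]
  change R.v (toFF (algebraMap K _ (c w))) * R.v (toFF (monom K q w)) < _
  rw [toFF_algebraMap, R.map_algebraMap _ (Finsupp.mem_support_iff.1 hw'), one_mul, hR]
  refine pow_lt_pow_right₀ ht (lt_of_le_of_ne (hmax w hw') fun h => ?_)
  exact Finset.ne_of_mem_erase hw (weight_injOn q (hc w hw') (hc z hz) h)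

theorem Place.v_smul (R : Place K (FunctionField K q)) {c : K} (hc : c ≠ 0)
    (f : CoordinateRing K q) : R.v (toFF (c • f)) = R.v (toFF f) := by
  rw [Algebra.smul_def, toFF, map_mul, map_mul]
  change R.v (toFF (algebraMap K _ c)) * R.v (toFF f) = _
  rw [toFF_algebraMap, R.map_algebraMap _ hc, one_mul]

/-- A surjective discrete valuation whose nonzero values are all powers of `t` is normalized by
`t = exp 1`. -/
theorem eq_exp_one_of_surjective {F : Type*} [Field F] (v : Valuation F (WithZero (Multiplicative ℤ)))
    (hv : Function.Surjective v) {t : WithZero (Multiplicative ℤ)} (ht : 1 < t)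
    (h : ∀ f : F, f ≠ 0 → ∃ k : ℤ, v f = t ^ k) : t = WithZero.exp 1 := by
  obtain ⟨f, hf⟩ := hv (WithZero.exp 1)
  obtain ⟨k, hk⟩ := h f (by rintro rfl; exact WithZero.exp_ne_zero ((map_zero v).symm.trans hf).symm)
  have ht0 : t ≠ 0 := (zero_lt_one.trans ht).ne'
  rw [← WithZero.exp_log ht0] at hk ht ⊢
  rw [hf, ← WithZero.exp_zsmul, WithZero.exp_inj, smul_eq_mul] at hk
  rw [← WithZero.exp_zero, WithZero.exp_lt_exp] at ht
  rw [WithZero.exp_inj]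
  exact (Int.eq_one_or_neg_one_of_mul_eq_one' hk.symm).elim (fun h => h.2) (fun h => by omega)

/-- By the leading term every nonzero function has value a power of t, so normalization of the
valuation forces t = `exp 1`. -/
theorem Place.v_monom (R : Place K (FunctionField K q)) (hR : R.IsPole (funX K q)) (z : ℕ × ℕ) :
    R.v (toFF (monom K q z)) = WithZero.exp (weight q z : ℤ) := by
  obtain ⟨t, ht, h⟩ := R.exists_pole_order hR
  have ht0 : t ≠ 0 := (zero_lt_one.trans ht).ne'
  have key (f : CoordinateRing K q) (hf : f ≠ 0) : ∃ k : ℕ, R.v (toFF f) = t ^ k := by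
    obtain ⟨z, -, c, hc, hz⟩ := exists_leading_term_aux f hf
    refine ⟨weight q z, ?_⟩
    have h1 := hz R t ht h
    have h2 : R.v (toFF (c • monom K q z)) = t ^ weight q z := by rw [R.v_smul hc, h]
    rw [← h2] at h1 ⊢
    rw [toFF, map_sub] at h1
    exact Valuation.map_eq_of_sub_lt _ h1
  have hte := eq_exp_one_of_surjective R.v R.surjective ht fun f hf => by
    obtain ⟨a, b, hb, rfl⟩ := IsFractionRing.div_surjective (A := CoordinateRing K q) f
    obtain ⟨k, hk⟩ := key a (by rintro rfl; simp at hf)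
    obtain ⟨l, hl⟩ := key b (nonZeroDivisors.ne_zero hb)
    refine ⟨k - l, ?_⟩
    rw [map_div₀]
    change R.v (toFF a) / R.v (toFF b) = _
    rw [hk, hl, zpow_sub₀ ht0, zpow_natCast, zpow_natCast]
  rw [h, hte, ← WithZero.exp_nsmul]
  simp

/-- Every nonzero regular function has a leading monomial, which determines its pole order at
infinity. -/
theorem exists_leading_term (f : CoordinateRing K q) (hf : f ≠ 0) :
    ∃ z : ℕ × ℕ, z.1 ≤ q ∧ ∃ c : K, c ≠ 0 ∧ ∀ R : Place K (FunctionField K q), R.IsPole (funX K q) →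
      R.v (toFF f) = WithZero.exp (weight q z : ℤ) ∧
      R.v (toFF (f - c • monom K q z)) < WithZero.exp (weight q z : ℤ) := by
  obtain ⟨z, hzq, c, hc, hz⟩ := exists_leading_term_aux f hf
  refine ⟨z, hzq, c, hc, fun R hR => ?_⟩
  have h := hz R (WithZero.exp 1) (by rw [← WithZero.exp_zero, WithZero.exp_lt_exp]; norm_num)
    (fun z => by rw [R.v_monom hR, ← WithZero.exp_nsmul]; simp)
  rw [← WithZero.exp_nsmul, nsmul_eq_mul, mul_one] at h
  refine ⟨?_, h⟩
  have h2 : R.v (toFF (c • monom K q z)) = WithZero.exp (weight q z : ℤ) := by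
    rw [R.v_smul hc, R.v_monom hR]
  rw [← h2] at h ⊢
  rw [toFF, map_sub] at h
  exact Valuation.map_eq_of_sub_lt _ h

/-- The leading monomial of a regular function does not depend on the pole, so it fixes the
valuation on the ring and then on fractions. -/
theorem Place.eq_of_isPole {R Q : Place K (FunctionField K q)} (hR : R.IsPole (funX K q))
    (hQ : Q.IsPole (funX K q)) : R = Q := by
  have key (f : CoordinateRing K q) : R.v (toFF f) = Q.v (toFF f) := by
    by_cases hf : f = 0
    · simp [hf, toFF]
    · obtain ⟨z, -, c, -, h⟩ := exists_leading_term f hf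
      rw [(h R hR).1, (h Q hQ).1]
  ext f
  obtain ⟨a, b, -, rfl⟩ := IsFractionRing.div_surjective (A := CoordinateRing K q) f
  rw [map_div₀, map_div₀]
  change R.v (toFF a) / R.v (toFF b) = Q.v (toFF a) / Q.v (toFF b)
  rw [key, key]

end Places

/-! ### Calculus of values at a place -/

section HasValue

variable {K F : Type*} [Field K] [Field F] [Algebra K F] {R : Place K F}

theorem Place.HasValue.le_one {f : F} {a : K} (h : R.HasValue f a) : R.v f ≤ 1 := by
  rw [← sub_add_cancel f (algebraMap K F a)]
  exact (R.v.map_add _ _).trans (max_le (le_of_lt h) (R.map_algebraMap_le a))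

theorem Place.hasValue_algebraMap (R : Place K F) (a : K) : R.HasValue (algebraMap K F a) a := by
  simp [Place.HasValue]

theorem Place.HasValue.add {f g : F} {a b : K} (hf : R.HasValue f a) (hg : R.HasValue g b) :
    R.HasValue (f + g) (a + b) := by
  have h := R.v.map_add_lt hf hg
  rwa [← add_sub_add_comm, ← map_add] at h

theorem Place.HasValue.mul {f g : F} {a b : K} (hf : R.HasValue f a) (hg : R.HasValue g b) :
    R.HasValue (f * g) (a * b) := by
  have h : f * g - algebraMap K F (a * b) =
      f * (g - algebraMap K F b) + algebraMap K F b * (f - algebraMap K F a) := by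
    rw [map_mul]; ring
  rw [Place.HasValue, h]
  refine R.v.map_add_lt ?_ ?_ <;> rw [map_mul]
  · exact (mul_le_of_le_one_left' hf.le_one).trans_lt hg
  · exact (mul_le_of_le_one_left' (R.map_algebraMap_le b)).trans_lt hf

theorem Place.HasValue.pow {f : F} {a : K} (hf : R.HasValue f a) (n : ℕ) :
    R.HasValue (f ^ n) (a ^ n) := by
  induction n with
  | zero => simpa using R.hasValue_algebraMap 1
  | succ n ih => rw [pow_succ, pow_succ]; exact ih.mul hf

theorem Place.HasValue.unique {f : F} {a b : K} (ha : R.HasValue f a) (hb : R.HasValue f b) :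
    a = b := by
  by_contra hab
  have h := R.v.map_sub_lt hb ha
  rw [sub_sub_sub_cancel_left, ← map_sub, R.map_algebraMap _ (sub_ne_zero.2 hab)] at h
  exact h.false

end HasValue

/-! ### Rational places as affine points, and one-point codes as evaluation codes -/

section Affine

variable {K : Type*} [Field K] {q : ℕ} [hq : Fact (IsPrimePow q)]

/-- The place `R` is centered at the affine point `z`. -/
def Place.IsAt (R : Place K (FunctionField K q)) (z : affinePoints K q) : Prop :=
  ∀ f : CoordinateRing K q, R.HasValue (toFF f) (evalHom z f)

theorem Place.IsRational.exists_isAt {R : Place K (FunctionField K q)} (hR : R.IsRational)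
    (hpole : ¬ R.IsPole (funX K q)) : ∃ z, R.IsAt z := by
  obtain ⟨a, ha⟩ := hR _ (R.toFF_le_one_of_not_isPole hpole (coordX K q))
  obtain ⟨b, hb⟩ := hR _ (R.toFF_le_one_of_not_isPole hpole (coordY K q))
  have h : a ^ (q + 1) = b ^ q + b := by
    refine (Place.HasValue.pow ha (q + 1)).unique ?_
    rw [← map_pow, coordX_pow, map_add, map_pow]
    exact (Place.HasValue.pow hb q).add hb
  refine ⟨⟨(a, b), h⟩, fun f => ?_⟩
  have hf : f ∈ Algebra.adjoin K {coordX K q, coordY K q} := by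
    rw [adjoin_coord_eq_top]; trivial
  induction hf using Algebra.adjoin_induction with
  | mem x hx' =>
    rcases hx' with rfl | rfl
    · rw [evalHom_coordX]; exact ha
    · rw [evalHom_coordY]; exact hb
  | algebraMap r => rw [toFF_algebraMap, AlgHom.commutes]; exact R.hasValue_algebraMap r
  | add x y _ _ h1 h2 => rw [toFF, map_add, map_add]; exact h1.add h2
  | mul x y _ _ h1 h2 => rw [toFF, map_mul, map_mul]; exact h1.mul h2

theorem Place.IsAt.not_isPole {R : Place K (FunctionField K q)} {z : affinePoints K q}
    (hR : R.IsAt z) : ¬ R.IsPole (funX K q) :=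
  (hR (coordX K q)).le_one.not_gt

theorem Place.IsAt.point_unique {R : Place K (FunctionField K q)} {z w : affinePoints K q}
    (hz : R.IsAt z) (hw : R.IsAt w) : z = w := by
  have hx := (hz (coordX K q)).unique (hw (coordX K q))
  have hy := (hz (coordY K q)).unique (hw (coordY K q))
  rw [evalHom_coordX, evalHom_coordX] at hx
  rw [evalHom_coordY, evalHom_coordY] at hy
  exact Subtype.ext (Prod.ext hx hy)

theorem Place.IsAt.v_eq_one {R : Place K (FunctionField K q)} {z : affinePoints K q}
    (hR : R.IsAt z) {f : CoordinateRing K q} (hf : evalHom z f ≠ 0) : R.v (toFF f) = 1 := by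
  rw [← R.map_algebraMap _ hf]
  refine Valuation.map_eq_of_sub_lt _ ?_
  rw [R.map_algebraMap _ hf]
  exact hR f

theorem Place.IsAt.v_lt_one {R : Place K (FunctionField K q)} {z : affinePoints K q}
    (hR : R.IsAt z) {f : CoordinateRing K q} (hf : evalHom z f = 0) : R.v (toFF f) < 1 := by
  have h := hR f
  rwa [Place.HasValue, hf, map_zero, sub_zero] at h

theorem ker_evalHom_ne_bot {Q : Place K (FunctionField K q)} (hQ : Q.IsPole (funX K q))
    (z : affinePoints K q) : RingHom.ker (evalHom z) ≠ ⊥ := by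
  intro h
  have h1 : coordX K q - algebraMap K _ z.1.1 ∈ RingHom.ker (evalHom z) := by
    rw [RingHom.mem_ker, map_sub, evalHom_coordX, AlgHom.commutes]
    exact sub_self _
  rw [h, Ideal.mem_bot, sub_eq_zero] at h1
  have h2 : 1 < Q.v (toFF (coordX K q)) := hQ
  rw [h1, toFF_algebraMap] at h2
  exact (Q.map_algebraMap_le _).not_gt h2

variable [IsDedekindDomain (CoordinateRing K q)]

/-- The place given by a nonzero prime ideal of the coordinate ring. -/
def Place.ofPrime (w : HeightOneSpectrum (CoordinateRing K q)) : Place K (FunctionField K q) where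
  v := w.valuation (FunctionField K q)
  map_algebraMap a ha := by
    rw [← toFF_algebraMap, HeightOneSpectrum.valuation_eq_one_iff_notMem]
    exact fun h => w.isPrime.ne_top (Ideal.eq_top_of_isUnit_mem _ h ((IsUnit.mk0 a ha).map _))
  surjective := w.valuation_surjective _

theorem Place.ofPrime_not_isPole (w : HeightOneSpectrum (CoordinateRing K q)) :
    ¬ (Place.ofPrime w).IsPole (funX K q) :=
  (w.valuation_le_one (K := FunctionField K q) (coordX K q)).not_gt

/-- The functions with poles only at infinity are the elements of the coordinate ring. -/
theorem mem_riemannRochSpace_single {Q : Place K (FunctionField K q)} (hQ : Q.IsPole (funX K q))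
    (μ : ℕ) (f : FunctionField K q) :
    f ∈ riemannRochSpace (Finsupp.single Q (μ : ℤ)) ↔
      ∃ g : CoordinateRing K q, toFF g = f ∧ Q.v (toFF g) ≤ WithZero.exp (μ : ℤ) := by
  constructor
  · intro hf
    -- In a Dedekind domain, integrality at every nonzero prime means membership. The places of
    -- these primes are not Q, because x is regular at them.
    obtain ⟨g, rfl⟩ := HeightOneSpectrum.mem_integers_of_valuation_le_one
      (R := CoordinateRing K q) (FunctionField K q) f fun w => by
        have h := hf (Place.ofPrime w)
        rwa [Finsupp.single_eq_of_ne, WithZero.exp_zero] at h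
        rintro rfl
        exact Place.ofPrime_not_isPole w hQ
    refine ⟨g, rfl, ?_⟩
    have h := hf Q
    rwa [Finsupp.single_eq_same] at h
  · rintro ⟨g, rfl, hg⟩ R
    by_cases hR : R = Q
    · rwa [hR, Finsupp.single_eq_same]
    · rw [Finsupp.single_eq_of_ne hR, WithZero.exp_zero]
      exact R.toFF_le_one_of_not_isPole (fun h => hR (Place.eq_of_isPole h hQ)) g

/-- The nonzero prime ideal of an affine point. -/
def pointPrime (z : affinePoints K q) (h : RingHom.ker (evalHom z) ≠ ⊥) :
    HeightOneSpectrum (CoordinateRing K q) :=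
  ⟨RingHom.ker (evalHom z), RingHom.ker_isPrime _, h⟩

theorem Place.ofPrime_pointPrime_isAt (z : affinePoints K q) (h : RingHom.ker (evalHom z) ≠ ⊥) :
    (Place.ofPrime (pointPrime z h)).IsAt z := by
  intro f
  rw [Place.HasValue, ← toFF_algebraMap, toFF, toFF, ← map_sub]
  refine ((pointPrime z h).valuation_lt_one_iff_mem _).2 ?_
  change _ ∈ RingHom.ker (evalHom z)
  rw [RingHom.mem_ker, map_sub, AlgHom.commutes]
  exact sub_self _

theorem Place.ofPrime_pointPrime_isRational (z : affinePoints K q)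
    (h : RingHom.ker (evalHom z) ≠ ⊥) : (Place.ofPrime (pointPrime z h)).IsRational := by
  intro f hf
  obtain ⟨g, hg⟩ := (pointPrime z h).exists_valuation_sub_lt_of_integer hf 1
  refine ⟨evalHom z g, ?_⟩
  have h1 := Place.ofPrime_pointPrime_isAt z h g
  have h2 := (Place.ofPrime (pointPrime z h)).v.map_sub_lt h1 (show _ < 1 from hg)
  rwa [sub_sub_sub_cancel_left] at h2

/-- The local ring of z lies in the valuation ring of R and its units remain units. So v_R is
determined by its value on a uniformizer π of the prime, and surjectivity makes that value the
normalized one. -/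
theorem Place.IsAt.eq_ofPrime {R : Place K (FunctionField K q)} {z : affinePoints K q}
    (hR : R.IsAt z) (h : RingHom.ker (evalHom z) ≠ ⊥) : R = Place.ofPrime (pointPrime z h) := by
  set w := pointPrime z h with hw
  have hle (f : FunctionField K q) (hf : w.valuation _ f ≤ 1) : R.v f ≤ 1 := by
    obtain ⟨a, ⟨b, hb⟩, hab⟩ := w.exists_primeCompl_mul_eq_of_integer f hf
    have h1 : R.v (toFF b) = 1 := hR.v_eq_one hb
    have h2 := congr_arg R.v hab
    rw [map_mul] at h2
    change R.v f * R.v (toFF b) = R.v (toFF a) at h2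
    rw [h1, mul_one] at h2
    rw [h2]
    exact R.toFF_le_one_of_not_isPole hR.not_isPole a
  have heq (f : FunctionField K q) (hf : w.valuation _ f = 1) : R.v f = 1 := by
    refine le_antisymm (hle f hf.le) ?_
    have h1 := hle f⁻¹ (by rw [map_inv₀, hf, inv_one])
    have hf0 : f ≠ 0 := by rintro rfl; simp at hf
    rw [map_inv₀] at h1
    exact (inv_le_one₀ (zero_lt_iff.2 ((Valuation.ne_zero_iff _).2 hf0))).1 h1
  obtain ⟨π, hπ⟩ := w.valuation_exists_uniformizer (FunctionField K q)
  have hπ0 : π ≠ 0 := by rintro rfl; exact WithZero.exp_ne_zero ((map_zero _).symm.trans hπ).symm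
  have hval (f : FunctionField K q) (hf : f ≠ 0) :
      R.v f = R.v π ^ (-(w.valuation _ f).log) := by
    have hf0 : w.valuation _ f ≠ 0 := (Valuation.ne_zero_iff _).2 hf
    have h1 := heq (f * π ^ (w.valuation _ f).log) (by
      rw [map_mul, map_zpow₀, hπ, ← WithZero.exp_zsmul]
      nth_rewrite 1 [← WithZero.exp_log hf0]
      rw [← WithZero.exp_add]
      simp)
    rw [map_mul, map_zpow₀] at h1
    rw [zpow_neg]
    exact eq_inv_of_mul_eq_one_left h1
  -- Write π = a/b with b nonvanishing at z. Then a lies in the prime, hence vanishes at z.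
  have hlt : R.v π < 1 := by
    obtain ⟨a, ⟨b, hb⟩, hab⟩ := w.exists_primeCompl_mul_eq_of_integer π (by
      rw [hπ, ← WithZero.exp_zero, WithZero.exp_le_exp]; norm_num)
    have h1 : R.v (toFF b) = 1 := hR.v_eq_one hb
    have h2 := congr_arg R.v hab
    rw [map_mul] at h2
    change R.v π * R.v (toFF b) = R.v (toFF a) at h2
    rw [h1, mul_one] at h2
    rw [h2]
    refine hR.v_lt_one ?_
    have h3 := congr_arg (w.valuation (FunctionField K q)) hab
    rw [map_mul, hπ, HeightOneSpectrum.valuation_eq_one_iff_notMem _ |>.2 hb, mul_one] at h3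
    have h4 : a ∈ w.asIdeal := by
      rw [← w.valuation_lt_one_iff_mem (K := FunctionField K q), ← h3, ← WithZero.exp_zero,
        WithZero.exp_lt_exp]
      norm_num
    exact h4
  have hπv : (R.v π)⁻¹ = WithZero.exp 1 := by
    refine eq_exp_one_of_surjective R.v R.surjective
      ((one_lt_inv₀ (zero_lt_iff.2 ((Valuation.ne_zero_iff _).2 hπ0))).2 hlt) fun f hf => ?_
    exact ⟨(w.valuation _ f).log, by rw [hval f hf, zpow_neg, inv_zpow]⟩
  ext f
  by_cases hf : f = 0
  · simp [hf]
  rw [hval f hf, zpow_neg, ← inv_zpow, hπv, ← WithZero.exp_zsmul]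
  simp only [smul_eq_mul, mul_one]
  exact WithZero.exp_log ((Valuation.ne_zero_iff _).2 hf)

/-- The rational places other than the pole of `x` correspond to the affine points. -/
theorem exists_equiv_affinePoints {Q : Place K (FunctionField K q)} (hQ : Q.IsPole (funX K q))
    {ι : Type*} {P : ι → Place K (FunctionField K q)} (hP : Function.Injective P)
    (hPrange : Set.range P = {R | R.IsRational ∧ R ≠ Q}) :
    ∃ e : ι ≃ affinePoints K q, ∀ i, (P i).IsAt (e i) := by
  have h1 (i : ι) : ∃ z, (P i).IsAt z := by
    have h : P i ∈ {R : Place K (FunctionField K q) | R.IsRational ∧ R ≠ Q} :=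
      hPrange ▸ Set.mem_range_self i
    exact h.1.exists_isAt fun hi => h.2 (Place.eq_of_isPole hi hQ)
  choose e he using h1
  refine ⟨Equiv.ofBijective e ⟨fun i j hij => hP ?_, fun z => ?_⟩, he⟩
  · have hj := he j
    rw [← hij] at hj
    rw [(he i).eq_ofPrime (ker_evalHom_ne_bot hQ _), hj.eq_ofPrime (ker_evalHom_ne_bot hQ _)]
  · have hz := Place.ofPrime_pointPrime_isAt z (ker_evalHom_ne_bot hQ z)
    have h : Place.ofPrime (pointPrime z (ker_evalHom_ne_bot hQ z)) ∈ Set.range P := by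
      rw [hPrange]
      exact ⟨Place.ofPrime_pointPrime_isRational _ _, fun h => hz.not_isPole (by rw [h]; exact hQ)⟩
    obtain ⟨i, hi⟩ := h
    refine ⟨i, (he i).point_unique ?_⟩
    rw [hi]
    exact hz

theorem mem_code {Q : Place K (FunctionField K q)} (hQ : Q.IsPole (funX K q)) {n : ℕ}
    {P : Fin n → Place K (FunctionField K q)} {e : Fin n ≃ affinePoints K q}
    (he : ∀ i, (P i).IsAt (e i)) (μ : ℕ) (c : Fin n → K) :
    c ∈ code P Q μ ↔ ∃ f : CoordinateRing K q, Q.v (toFF f) ≤ WithZero.exp (μ : ℤ) ∧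
      ∀ i, evalHom (e i) f = c i := by
  constructor
  · rintro ⟨_, hf, hc⟩
    obtain ⟨f, rfl, hf'⟩ := (mem_riemannRochSpace_single hQ μ _).1 hf
    exact ⟨f, hf', fun i => (he i f).unique (hc i)⟩
  · rintro ⟨f, hf, hc⟩
    exact ⟨toFF f, (mem_riemannRochSpace_single hQ μ _).2 ⟨f, rfl, hf⟩, fun i => hc i ▸ he i f⟩

end Affine

/-! ### The semigroup generated by q and q + 1, and its footprint bound -/

section Semigroup

/-- The numerical semigroup generated by `q` and `q + 1`. -/
def semigroup (q : ℕ) : Set ℕ := Set.range (weight q)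

theorem semigroup_add {q α β : ℕ} (hα : α ∈ semigroup q) (hβ : β ∈ semigroup q) :
    α + β ∈ semigroup q := by
  obtain ⟨z, rfl⟩ := hα
  obtain ⟨w, rfl⟩ := hβ
  exact ⟨z + w, weight_add q z w⟩

theorem weight_eq (q i j : ℕ) : weight q (i, j) = (i + j) * q + j := by
  simp [weight]; ring

/-- The weight of (i, j) is (i+j)q + j, so remainder and quotient can serve as j and i + j. -/
theorem mem_semigroup_of_mod_le_div {q α : ℕ} (h : α % q ≤ α / q) : α ∈ semigroup q := by
  refine ⟨(α / q - α % q, α % q), ?_⟩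
  rw [weight_eq, Nat.sub_add_cancel h, mul_comm]
  exact Nat.div_add_mod α q

theorem mem_semigroup_of_le {q α : ℕ} (hq : 0 < q) (h : q * (q - 1) ≤ α) : α ∈ semigroup q := by
  refine mem_semigroup_of_mod_le_div ?_
  have h1 := Nat.mod_lt α hq
  have h2 : q - 1 ≤ α / q := by rwa [Nat.le_div_iff_mul_le hq, mul_comm]
  omega

/-- The elements of the semigroup that are not in `γ + semigroup q` for any `γ ∈ Γ`. -/
def footprint (q : ℕ) (Γ : Finset ℕ) : Set ℕ :=
  {α ∈ semigroup q | ∀ γ ∈ Γ, ∀ β ∈ semigroup q, α ≠ γ + β}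

/-- Of two congruent semigroup elements the larger is the smaller plus a positive multiple of g,
hence lies in g + H. -/
theorem injOn_mod_footprint {q g : ℕ} (hg : g ∈ semigroup q) :
    Set.InjOn (· % g) (footprint q {g}) := by
  have key : ∀ k : ℕ, k * g ∈ semigroup q := fun k => by
    induction k with
    | zero => exact ⟨0, by simp [weight]⟩
    | succ k ih => rw [Nat.succ_mul]; exact semigroup_add ih hg
  have hlt : ∀ α ∈ footprint q {g}, ∀ β ∈ footprint q {g}, α % g = β % g → ¬ α < β := by
    intro α hα β hβ h hlt
    obtain ⟨k, hk⟩ := (Nat.modEq_iff_dvd' hlt.le).1 h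
    obtain ⟨k, rfl⟩ : ∃ l, k = l + 1 := ⟨k - 1, by
      have : k ≠ 0 := by rintro rfl; omega
      omega⟩
    refine hβ.2 g (Finset.mem_singleton_self g) (α + k * g) (semigroup_add hα.1 (key k)) ?_
    have : g * (k + 1) = g + k * g := by ring
    omega
  intro α hα β hβ h
  exact le_antisymm (not_lt.1 (hlt β hβ α hα h.symm)) (not_lt.1 (hlt α hα β hβ h))

theorem footprint_singleton {q g : ℕ} (hg : g ∈ semigroup q) :
    (footprint q {g}).Finite ∧ (footprint q {g}).ncard ≤ g := by
  rcases Nat.eq_zero_or_pos g with rfl | hpos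
  · have h : footprint q {0} = ∅ := by
      ext α
      simp only [footprint, Set.mem_ofPred_eq, Set.mem_empty_iff_false, iff_false, not_and]
      intro hα h
      exact h 0 (Finset.mem_singleton_self 0) α hα (zero_add α).symm
    simp [h]
  · have hmaps : Set.MapsTo (· % g) (footprint q {g}) (Finset.range g : Set ℕ) := fun α _ => by
      simpa using Nat.mod_lt α hpos
    refine ⟨Set.Finite.of_injOn hmaps (injOn_mod_footprint hg) (Finset.finite_toSet _), ?_⟩
    have h := Set.ncard_le_ncard_of_injOn _ hmaps (injOn_mod_footprint hg) (Finset.finite_toSet _)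
    rwa [Set.ncard_coe_finset, Finset.card_range] at h

/-- The pairs `t ≤ s` in `[1, q]` with `t ∈ S` or `s ∈ S`. -/
def pairsMeeting (q : ℕ) (S : Finset ℕ) : Finset (ℕ × ℕ) :=
  (Finset.Icc 1 q ×ˢ Finset.Icc 1 q).filter fun z => z.1 ≤ z.2 ∧ (z.1 ∈ S ∨ z.2 ∈ S)

/-- Adding x to S creates the pairs formed by x and each y in [1, q] outside S, y = x included: q -
#S new ones. -/
theorem le_card_pairsMeeting (q : ℕ) (S : Finset ℕ) (hS : S ⊆ Finset.Icc 1 q) :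
    ∑ s ∈ Finset.range S.card, (q - s) ≤ (pairsMeeting q S).card := by
  induction S using Finset.induction_on with
  | empty => simp
  | insert x S hx ih =>
    have hS' : S ⊆ Finset.Icc 1 q := (Finset.subset_insert _ _).trans hS
    have hxq := hS (Finset.mem_insert_self x S)
    rw [Finset.card_insert_of_notMem hx, Finset.sum_range_succ]
    let N := (Finset.Icc 1 q \ S).image fun y => (min x y, max x y)
    have hN : N.card = q - S.card := by
      rw [Finset.card_image_of_injOn, Finset.card_sdiff_of_subset hS', Nat.card_Icc,
        Nat.add_sub_cancel]
      intro y _ y' _ h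
      simp only [Prod.mk.injEq] at h
      omega
    have hdisj : Disjoint (pairsMeeting q S) N := by
      rw [Finset.disjoint_left]
      rintro ⟨t, s⟩ h1 h2
      simp only [pairsMeeting, Finset.mem_filter] at h1
      simp only [N, Finset.mem_image, Finset.mem_sdiff, Prod.mk.injEq] at h2
      obtain ⟨y, ⟨-, hy⟩, rfl, rfl⟩ := h2
      rcases le_total x y with h | h <;> simp [h, hx, hy] at h1
    calc _ ≤ (pairsMeeting q S).card + N.card := by rw [hN]; exact Nat.add_le_add_right (ih hS') _
      _ = (pairsMeeting q S ∪ N).card := (Finset.card_union_of_disjoint hdisj).symm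
      _ ≤ _ := Finset.card_le_card ?_
    intro z hz
    rw [Finset.mem_union] at hz
    simp only [pairsMeeting, Finset.mem_filter, Finset.mem_insert, Finset.mem_product] at hz ⊢
    rcases hz with hz | hz
    · tauto
    · simp only [N, Finset.mem_image, Finset.mem_sdiff] at hz
      obtain ⟨y, ⟨hy, -⟩, rfl⟩ := hz
      simp only [Finset.mem_Icc] at hy hxq
      rcases le_total x y with h | h <;> simp [h] <;> omega

/-- The footprint bound for the semigroup generated by `q` and `q + 1`. -/
theorem footprint_bound {q : ℕ} {Γ : Finset ℕ} (hΓ : ∀ γ ∈ Γ, γ ∈ semigroup q) {g : ℕ} (hg : g ∈ Γ)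
    (hmax : ∀ γ ∈ Γ, γ ≤ g) (hq : ∀ γ ∈ Γ, g ≤ γ + q) :
    (footprint q Γ).Finite ∧
      (footprint q Γ).ncard + ∑ s ∈ Finset.range (Γ.card - 1), (q - s) ≤ g := by
  obtain ⟨hfin, hcard⟩ := footprint_singleton (hΓ g hg)
  have hsub : footprint q Γ ⊆ footprint q {g} := fun α hα =>
    ⟨hα.1, fun γ hγ => hα.2 γ (Finset.mem_singleton.1 hγ ▸ hg)⟩
  refine ⟨hfin.subset hsub, ?_⟩
  -- The distances δ = g - γ of the other orders from the maximum; all lie in [1, q].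
  let S := (Γ.erase g).image (g - ·)
  have hS : S ⊆ Finset.Icc 1 q := by
    intro δ hδ
    simp only [S, Finset.mem_image, Finset.mem_erase] at hδ
    obtain ⟨γ, ⟨hne, hγ⟩, rfl⟩ := hδ
    have h1 := hmax γ hγ
    have h2 := hq γ hγ
    rw [Finset.mem_Icc]
    omega
  have hScard : S.card = Γ.card - 1 := by
    rw [Finset.card_image_of_injOn, Finset.card_erase_of_mem hg]
    intro γ hγ γ' hγ' h
    have h1 := hmax γ (Finset.mem_of_mem_erase hγ)
    have h2 := hmax γ' (Finset.mem_of_mem_erase hγ')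
    simp only at h
    omega
  -- For t ≤ δ ≤ s with g = γ + δ, the number g + (s-t)q - t equals γ + (s-t)q + (δ-t), and 0 ≤ δ-t
  -- ≤ s-t puts it in γ + H. It is not in g + H.
  let φ : ℕ × ℕ → ℕ := fun z => g + (z.2 - z.1) * q - z.1
  have hmem : ∀ z ∈ pairsMeeting q S, 1 ≤ z.1 ∧ z.1 ≤ z.2 ∧ z.2 ≤ q ∧
      ∃ γ ∈ Γ, ∃ δ, g = γ + δ ∧ z.1 ≤ δ ∧ δ ≤ z.2 := by
    rintro ⟨t, s⟩ hz
    simp only [pairsMeeting, Finset.mem_filter, Finset.mem_product, Finset.mem_Icc] at hz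
    refine ⟨hz.1.1.1, hz.2.1, hz.1.2.2, ?_⟩
    rcases hz.2.2 with h | h <;>
    · simp only [S, Finset.mem_image, Finset.mem_erase] at h
      obtain ⟨γ, ⟨-, hγ⟩, hδ⟩ := h
      have := hmax γ hγ
      exact ⟨γ, hγ, g - γ, by omega, by omega, by omega⟩
  have hφ : Set.InjOn φ (pairsMeeting q S : Set (ℕ × ℕ)) := by
    rintro ⟨t, s⟩ hz ⟨t', s'⟩ hz' h
    obtain ⟨h1, h2, h3, γ, -, δ, h4, h5, h6⟩ := hmem _ hz
    obtain ⟨h1', h2', h3', γ', -, δ', h4', h5', h6'⟩ := hmem _ hz'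
    simp only at h1 h2 h3 h5 h6 h1' h2' h3' h5' h6'
    simp only [φ] at h
    obtain ⟨a, rfl⟩ := Nat.exists_eq_add_of_le h2
    obtain ⟨a', rfl⟩ := Nat.exists_eq_add_of_le h2'
    simp only [Nat.add_sub_cancel_left] at h
    have h7 : a * q + t' = a' * q + t := by omega
    have h8 : a = a' := by
      rcases lt_trichotomy a a' with hlt | heq | hlt
      · have := Nat.mul_le_mul_right q hlt
        rw [Nat.succ_mul] at this
        omega
      · exact heq
      · have := Nat.mul_le_mul_right q hlt
        rw [Nat.succ_mul] at this
        omega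
    subst h8
    simp only [Prod.mk.injEq]
    omega
  have hsub' : ((pairsMeeting q S).image φ : Set ℕ) ⊆ footprint q {g} \ footprint q Γ := by
    intro v hv
    obtain ⟨⟨t, s⟩, hz, rfl⟩ := Finset.mem_image.1 (Finset.mem_coe.1 hv)
    obtain ⟨h1, h2, h3, γ, hγ, δ, h4, h5, h6⟩ := hmem _ hz
    simp only at h1 h2 h3 h5 h6
    obtain ⟨a, rfl⟩ := Nat.exists_eq_add_of_le h2
    have hv : φ (t, t + a) = γ + weight q (a - (δ - t), δ - t) := by
      rw [weight_eq, Nat.sub_add_cancel (by omega)]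
      simp only [φ, Nat.add_sub_cancel_left]
      omega
    rw [hv]
    refine ⟨⟨semigroup_add (hΓ γ hγ) ⟨_, rfl⟩, ?_⟩, fun h => h.2 γ hγ _ ⟨_, rfl⟩ rfl⟩
    rintro γ' hγ' _ ⟨⟨i, j⟩, rfl⟩
    rw [Finset.mem_singleton.1 hγ', ← hv, weight_eq]
    simp only [φ, Nat.add_sub_cancel_left]
    intro h
    have h7 : a * q = (i + j) * q + j + t := by omega
    have h8 : i + j < a := by
      -- Since t ≥ 1, i + j ≥ a would make the right side of `h7` too large. With a = i + j + b + 1,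
      -- `h7` reads (b+1)q = j + t, impossible as j + t < t + a ≤ q.
      by_contra! h8
      have := Nat.mul_le_mul_right q h8
      omega
    obtain ⟨b, rfl⟩ := Nat.exists_eq_add_of_lt h8
    have h9 : (i + j + b + 1) * q = (i + j) * q + b * q + q := by ring
    omega
  have h1 : (pairsMeeting q S).card ≤ (footprint q {g} \ footprint q Γ).ncard := by
    rw [← Finset.card_image_of_injOn hφ, ← Set.ncard_coe_finset]
    exact Set.ncard_le_ncard hsub' (hfin.subset Set.sdiff_subset)
  have h2 := le_card_pairsMeeting q S hS
  have h3 := Set.ncard_sdiff_add_ncard_of_subset hsub hfin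
  rw [hScard] at h2
  omega

end Semigroup

/-! ### Relative dimension and relative weights -/

section RelDim

variable {K : Type*} [Field K] {ι : Type*} [Fintype ι] {C₁ C₂ : Submodule K (ι → K)}

theorem relDim_add_finrank (h : C₂ ≤ C₁) (I : Finset ι) :
    relDim C₁ C₂ I + Module.finrank K ↥(C₂ ⊓ supportedOn K I) =
      Module.finrank K ↥(C₁ ⊓ supportedOn K I) := by
  have hle : C₂ ⊓ supportedOn K I ≤ C₁ ⊓ supportedOn K I := inf_le_inf_right _ h
  rw [relDim, ← (Submodule.submoduleOfEquivOfLe hle).finrank_eq]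
  exact Submodule.finrank_quotient_add_finrank _

theorem relDim_empty : relDim C₁ C₂ (∅ : Finset ι) = 0 := by
  have h : C₁ ⊓ supportedOn K (∅ : Finset ι) = ⊥ := by
    rw [eq_bot_iff]
    rintro c ⟨-, hc⟩
    ext i
    exact hc i (Finset.notMem_empty i)
  have h1 : Module.finrank K ↥(C₁ ⊓ supportedOn K (∅ : Finset ι)) = 0 := by rw [h]; exact finrank_bot K _
  have h2 := Submodule.finrank_quotient_le
    ((C₂ ⊓ supportedOn K (∅ : Finset ι)).submoduleOf (C₁ ⊓ supportedOn K (∅ : Finset ι)))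
  exact Nat.eq_zero_of_le_zero (h2.trans h1.le)

theorem supportedOn_univ : supportedOn K (Finset.univ : Finset ι) = ⊤ := by
  rw [eq_top_iff]
  exact fun c _ i hi => absurd (Finset.mem_univ i) hi

theorem relDim_univ (h : C₂ ≤ C₁) :
    relDim C₁ C₂ Finset.univ = Module.finrank K C₁ - Module.finrank K C₂ := by
  have h1 := relDim_add_finrank h Finset.univ
  rw [supportedOn_univ, inf_top_eq, inf_top_eq] at h1
  omega

theorem finrank_le_add_one_of_inf_ker_le {V : Type*} [AddCommGroup V] [Module K V]
    [FiniteDimensional K V] {W W' : Submodule K V} (φ : V →ₗ[K] K)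
    (h : W ⊓ LinearMap.ker φ ≤ W') : Module.finrank K W ≤ Module.finrank K W' + 1 := by
  have h1 := LinearMap.finrank_range_add_finrank_ker (φ.domRestrict W)
  have h2 : Module.finrank K (LinearMap.range (φ.domRestrict W)) ≤ 1 :=
    (Submodule.finrank_le _).trans (Module.finrank_self K).le
  have h3 : Module.finrank K (LinearMap.ker (φ.domRestrict W)) ≤ Module.finrank K W' := by
    rw [← Submodule.finrank_map_subtype_eq W (LinearMap.ker (φ.domRestrict W))]
    refine Submodule.finrank_mono ?_
    rintro _ ⟨⟨w, hw⟩, hw', rfl⟩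
    exact h ⟨hw, hw'⟩
  omega

/-- The `C₁` part grows by at most one dimension, as one coordinate functional cuts it back; the
`C₂` part does not shrink. -/
theorem relDim_insert_le [DecidableEq ι] (h : C₂ ≤ C₁) (I : Finset ι) (i : ι) :
    relDim C₁ C₂ (insert i I) ≤ relDim C₁ C₂ I + 1 := by
  have h1 := relDim_add_finrank h I
  have h2 := relDim_add_finrank h (insert i I)
  have h3 : Module.finrank K ↥(C₂ ⊓ supportedOn K I) ≤
      Module.finrank K ↥(C₂ ⊓ supportedOn K (insert i I)) :=
    Submodule.finrank_mono (inf_le_inf_left _ fun c hc j hj =>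
      hc j fun hj' => hj (Finset.mem_insert_of_mem hj'))
  have h4 : Module.finrank K ↥(C₁ ⊓ supportedOn K (insert i I)) ≤
      Module.finrank K ↥(C₁ ⊓ supportedOn K I) + 1 := by
    refine finrank_le_add_one_of_inf_ker_le (LinearMap.proj i) ?_
    rintro c ⟨⟨hc, hcI⟩, hi⟩
    refine ⟨hc, fun j hj => ?_⟩
    by_cases hji : j = i
    · exact hji ▸ hi
    · exact hcI j (by simp [hji, hj])
  omega

/-- A discrete intermediate value argument: the relative dimension is 0 on the empty set and rises
by at most 1 per point. -/
theorem exists_subset_relDim_eq (h : C₂ ≤ C₁) {I : Finset ι} {m : ℕ} (hm : m ≤ relDim C₁ C₂ I) :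
    ∃ I' ⊆ I, relDim C₁ C₂ I' = m := by
  classical
  induction I using Finset.induction_on with
  | empty => exact ⟨∅, le_rfl, by rw [relDim_empty] at hm ⊢; omega⟩
  | insert i I _ ih =>
    by_cases hI : m ≤ relDim C₁ C₂ I
    · obtain ⟨I', hI', hm'⟩ := ih hI
      exact ⟨I', hI'.trans (Finset.subset_insert _ _), hm'⟩
    · have := relDim_insert_le h I i
      exact ⟨insert i I, le_rfl, by omega⟩

/-- The bound on m ensures that some I attains m; otherwise the infimum would be the default value
0. -/
theorem le_rghw (h : C₂ ≤ C₁) {m B : ℕ} (hm : m ≤ Module.finrank K C₁ - Module.finrank K C₂)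
    (hB : ∀ I : Finset ι, relDim C₁ C₂ I = m → B ≤ I.card) : B ≤ rghw C₁ C₂ m := by
  rw [← relDim_univ h] at hm
  obtain ⟨I, -, hI⟩ := exists_subset_relDim_eq h hm
  refine le_csInf ⟨I.card, I, rfl, hI⟩ ?_
  rintro _ ⟨I, rfl, hI⟩
  exact hB I hI

theorem rghw_le (h : C₂ ≤ C₁) {m : ℕ} {I : Finset ι} (hm : m ≤ relDim C₁ C₂ I) :
    rghw C₁ C₂ m ≤ I.card := by
  obtain ⟨I', hI', hm'⟩ := exists_subset_relDim_eq h hm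
  have h1 : rghw C₁ C₂ m ≤ I'.card := Nat.sInf_le ⟨I', rfl, hm'⟩
  exact h1.trans (Finset.card_le_card hI')

end RelDim

/-! ### Interpolation at affine points -/

section Evaluation

variable {K : Type*} [Field K] {q : ℕ}

/-- Simultaneous evaluation at a family of affine points. -/
def evalLin {ι : Type*} (e : ι → affinePoints K q) : CoordinateRing K q →ₗ[K] (ι → K) :=
  LinearMap.pi fun i => (evalHom (e i)).toLinearMap

@[simp] theorem evalLin_apply {ι : Type*} (e : ι → affinePoints K q) (f : CoordinateRing K q) (i : ι) :
    evalLin e f i = evalHom (e i) f := rfl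

theorem exists_separating {z w : affinePoints K q} (h : z ≠ w) :
    ∃ f : CoordinateRing K q, evalHom z f ≠ 0 ∧ evalHom w f = 0 := by
  by_cases hx : z.1.1 = w.1.1
  · have hy : z.1.2 ≠ w.1.2 := fun hy => h (Subtype.ext (Prod.ext hx hy))
    exact ⟨coordY K q - algebraMap K _ w.1.2, by simpa [sub_eq_zero] using hy, by simp⟩
  · exact ⟨coordX K q - algebraMap K _ w.1.1, by simpa [sub_eq_zero] using hx, by simp⟩

theorem evalLin_surjective {ι : Type*} [Finite ι] {e : ι → affinePoints K q}
    (he : Function.Injective e) : Function.Surjective (evalLin e) := by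
  classical
  have := Fintype.ofFinite ι
  have hsep (i j : ι) : ∃ f : CoordinateRing K q, i ≠ j → evalHom (e i) f ≠ 0 ∧ evalHom (e j) f = 0 := by
    by_cases h : i = j
    · exact ⟨0, fun h' => absurd h h'⟩
    · obtain ⟨f, hf⟩ := exists_separating (he.ne h)
      exact ⟨f, fun _ => hf⟩
  choose s hs using hsep
  rw [← LinearMap.range_eq_top, eq_top_iff, ← (Pi.basisFun K ι).span_eq, Submodule.span_le]
  rintro _ ⟨i, rfl⟩
  let g := ∏ j ∈ Finset.univ.erase i, s i j
  have hg : evalHom (e i) g ≠ 0 := by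
    rw [map_prod, Finset.prod_ne_zero_iff]
    exact fun j hj => (hs i j (Finset.ne_of_mem_erase hj).symm).1
  refine ⟨(evalHom (e i) g)⁻¹ • g, ?_⟩
  ext j
  rw [evalLin_apply, map_smul, smul_eq_mul, Pi.basisFun_apply]
  by_cases hj : j = i
  · subst hj
    rw [inv_mul_cancel₀ hg, Pi.single_eq_same]
  · rw [Pi.single_eq_of_ne hj]
    refine mul_eq_zero_of_right _ ?_
    rw [map_prod]
    exact Finset.prod_eq_zero (Finset.mem_erase.2 ⟨hj, Finset.mem_univ j⟩) (hs i j (Ne.symm hj)).2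

end Evaluation

/-! ### Filtration by pole order and common zeros -/

section PoleOrder

variable {K : Type*} [Field K] {q : ℕ} [hq : Fact (IsPrimePow q)]

/-- The regular functions with pole order at most `μ` at `Q`. -/
def regularSpace (Q : Place K (FunctionField K q)) (μ : ℕ) : Submodule K (CoordinateRing K q) where
  carrier := {f | Q.v (toFF f) ≤ WithZero.exp (μ : ℤ)}
  zero_mem' := by simp [toFF]
  add_mem' {f g} hf hg := by
    simp only [Set.mem_ofPred_eq, toFF, map_add] at *
    exact (Q.v.map_add _ _).trans (max_le hf hg)
  smul_mem' a f hf := by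
    by_cases ha : a = 0
    · simp [ha, toFF]
    · simp only [Set.mem_ofPred_eq] at *
      rwa [Q.v_smul ha]

/-- The regular function `f` has pole order exactly `α` at `Q`. -/
def HasPoleOrder (Q : Place K (FunctionField K q)) (f : CoordinateRing K q) (α : ℕ) : Prop :=
  Q.v (toFF f) = WithZero.exp (α : ℤ)

variable {Q : Place K (FunctionField K q)}

theorem HasPoleOrder.mul {f g : CoordinateRing K q} {α β : ℕ} (hf : HasPoleOrder Q f α)
    (hg : HasPoleOrder Q g β) : HasPoleOrder Q (f * g) (α + β) := by
  unfold HasPoleOrder at *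
  rw [toFF, map_mul, map_mul]
  change Q.v (toFF f) * Q.v (toFF g) = _
  rw [hf, hg, ← WithZero.exp_add, Nat.cast_add]

theorem HasPoleOrder.unique {f : CoordinateRing K q} {α β : ℕ} (h : HasPoleOrder Q f α)
    (h' : HasPoleOrder Q f β) : α = β := by
  have h1 := h.symm.trans h'
  rw [WithZero.exp_inj] at h1
  exact_mod_cast h1

theorem HasPoleOrder.mem_regularSpace {f : CoordinateRing K q} {α μ : ℕ} (h : HasPoleOrder Q f α) :
    f ∈ regularSpace Q μ ↔ α ≤ μ := by
  change Q.v (toFF f) ≤ _ ↔ _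
  rw [h, WithZero.exp_le_exp, Nat.cast_le]

theorem hasPoleOrder_monom (hQ : Q.IsPole (funX K q)) (z : ℕ × ℕ) :
    HasPoleOrder Q (monom K q z) (weight q z) := Q.v_monom hQ z

theorem exists_hasPoleOrder (hQ : Q.IsPole (funX K q)) {f : CoordinateRing K q} (hf : f ≠ 0) :
    ∃ α ∈ semigroup q, HasPoleOrder Q f α := by
  obtain ⟨z, -, c, -, h⟩ := exists_leading_term f hf
  exact ⟨_, ⟨z, rfl⟩, (h Q hQ).1⟩

theorem HasPoleOrder.ne_zero {f : CoordinateRing K q} {α : ℕ} (h : HasPoleOrder Q f α) : f ≠ 0 := by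
  rintro rfl
  rw [HasPoleOrder, toFF, map_zero, map_zero] at h
  exact WithZero.exp_ne_zero h.symm

/-- Equal orders mean equal leading monomials, so a scalar multiple cancels them. -/
theorem HasPoleOrder.exists_sub_lt (hQ : Q.IsPole (funX K q)) {f g : CoordinateRing K q} {α : ℕ}
    (hf : HasPoleOrder Q f α) (hg : HasPoleOrder Q g α) :
    ∃ c : K, Q.v (toFF (f - c • g)) < WithZero.exp (α : ℤ) := by
  obtain ⟨z, hz, c, hc, h⟩ := exists_leading_term f hf.ne_zero
  obtain ⟨w, hw, d, hd, h'⟩ := exists_leading_term g hg.ne_zero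
  have h1 := hf.unique (h Q hQ).1
  have h2 := hg.unique (h' Q hQ).1
  obtain rfl := weight_injOn q hz hw (h1.symm.trans h2)
  refine ⟨c / d, ?_⟩
  have h3 : f - (c / d) • g = (f - c • monom K q z) - (c / d) • (g - d • monom K q z) := by
    rw [smul_sub, smul_smul, div_mul_cancel₀ _ hd]
    abel
  rw [h3, toFF, map_sub, h1]
  refine Q.v.map_sub_lt (h Q hQ).2 ?_
  change Q.v (toFF _) < _
  rw [Q.v_smul (div_ne_zero hc hd)]
  exact (h' Q hQ).2

/-- Comparison of spaces of regular functions by pole orders. -/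
theorem le_of_hasPoleOrder (hQ : Q.IsPole (funX K q)) {T U : Submodule K (CoordinateRing K q)}
    (hUT : U ≤ T) (h : ∀ f ∈ T, ∀ α ∈ semigroup q, HasPoleOrder Q f α → ∃ u ∈ U, HasPoleOrder Q u α) :
    T ≤ U := by
  have key : ∀ α : ℕ, ∀ f ∈ T, HasPoleOrder Q f α → f ∈ U := by
    intro α
    induction α using Nat.strong_induction_on with
    | _ α ih =>
      intro f hf hα
      obtain ⟨β, hβ, hfβ⟩ := exists_hasPoleOrder hQ hα.ne_zero
      obtain ⟨u, hu, huα⟩ := h f hf α (hα.unique hfβ ▸ hβ) hα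
      obtain ⟨c, hc⟩ := hα.exists_sub_lt hQ huα
      have hcu := U.smul_mem c hu
      by_cases h0 : f - c • u = 0
      · rwa [sub_eq_zero.1 h0]
      · obtain ⟨β, -, hβ⟩ := exists_hasPoleOrder hQ h0
        rw [hβ, WithZero.exp_lt_exp, Nat.cast_lt] at hc
        have h1 := ih β hc _ (T.sub_mem hf (hUT hcu)) hβ
        have h2 := U.add_mem h1 hcu
        rwa [sub_add_cancel] at h2
  intro f hf
  by_cases h0 : f = 0
  · rw [h0]; exact U.zero_mem
  · obtain ⟨α, -, hα⟩ := exists_hasPoleOrder hQ h0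
    exact key α f hf hα

/-- Common zeros of functions with given pole orders are bounded by the footprint. -/
theorem card_common_zeros_le (hQ : Q.IsPole (funX K q)) {Γ : Finset ℕ} {F : ℕ → CoordinateRing K q}
    (hF : ∀ γ ∈ Γ, HasPoleOrder Q (F γ) γ) (hfin : (footprint q Γ).Finite)
    {J : Finset (affinePoints K q)} (hJ : ∀ z ∈ J, ∀ γ ∈ Γ, evalHom z (F γ) = 0) :
    J.card ≤ (footprint q Γ).ncard := by
  classical
  have hrep (α : ℕ) : ∃ z, α ∈ semigroup q → weight q z = α := by
    by_cases h : α ∈ semigroup q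
    · obtain ⟨z, hz⟩ := h
      exact ⟨z, fun _ => hz⟩
    · exact ⟨0, fun h' => absurd h' h⟩
  choose z hz using hrep
  let M := hfin.toFinset.image fun α => monom K q (z α)
  let N : Submodule K (CoordinateRing K q) := (Ideal.span (F '' Γ)).restrictScalars K
  -- Modulo the ideal of the F γ, the footprint monomials span: any other order is γ + β, realized
  -- by F γ times a monomial of weight β.
  have htop : (⊤ : Submodule K (CoordinateRing K q)) ≤ N ⊔ Submodule.span K M := by
    refine le_of_hasPoleOrder hQ le_top fun f _ α hα _ => ?_
    by_cases h : α ∈ footprint q Γ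
    · refine ⟨monom K q (z α), Submodule.mem_sup_right (Submodule.subset_span ?_), ?_⟩
      · exact Finset.mem_coe.2 (Finset.mem_image_of_mem _ (hfin.mem_toFinset.2 h))
      · have h1 := hasPoleOrder_monom hQ (z α)
        rwa [hz α hα] at h1
    · have h1 : ∃ γ ∈ Γ, ∃ β ∈ semigroup q, α = γ + β := by
        by_contra! h1
        exact h ⟨hα, h1⟩
      obtain ⟨γ, hγ, _, ⟨w, rfl⟩, rfl⟩ := h1
      refine ⟨F γ * monom K q w, Submodule.mem_sup_left ?_, (hF γ hγ).mul (hasPoleOrder_monom hQ w)⟩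
      exact Ideal.mul_mem_right _ _ (Ideal.subset_span ⟨γ, hγ, rfl⟩)
  let ev := evalLin (fun j : J => j.1)
  have hN : N ≤ LinearMap.ker ev := by
    intro f hf
    have hf' : f ∈ Ideal.span (F '' Γ) := hf
    rw [LinearMap.mem_ker]
    ext j
    have h1 : Ideal.span (F '' Γ) ≤ RingHom.ker (evalHom j.1) := by
      rw [Ideal.span_le]
      rintro _ ⟨γ, hγ, rfl⟩
      exact hJ j.1 j.2 γ hγ
    exact h1 hf'
  -- Evaluation on J is onto and kills the ideal, so the images of the footprint monomials span K^J.
  have h1 : (⊤ : Submodule K (J → K)) ≤ Submodule.span K (M.image ev : Finset (J → K)) := by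
    rw [← LinearMap.range_eq_top.2 (evalLin_surjective (e := fun j : J => j.1) Subtype.val_injective),
      LinearMap.range_eq_map]
    refine (Submodule.map_mono htop).trans ?_
    rw [Submodule.map_sup, Submodule.map_span]
    exact sup_le ((Submodule.map_le_iff_le_comap.2 hN).trans bot_le)
      (by rw [Finset.coe_image (s := M)])
  have h2 := finrank_span_finset_le_card (R := K) (M.image ev)
  rw [Set.finrank, top_le_iff.1 h1, finrank_top, Module.finrank_fintype_fun_eq_card,
    Fintype.card_coe] at h2
  refine h2.trans (Finset.card_image_le.trans (Finset.card_image_le.trans ?_))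
  rw [Set.ncard_eq_toFinset_card _ hfin]

end PoleOrder

/-! ### The lower bound -/

section LowerBound

variable {K : Type*} [Field K] {q : ℕ} [hq : Fact (IsPrimePow q)]
variable {Q : Place K (FunctionField K q)}

theorem regularSpace_mono {μ₁ μ₂ : ℕ} (h : μ₂ ≤ μ₁) : regularSpace Q μ₂ ≤ regularSpace Q μ₁ :=
  by
  intro f hf
  have h1 : WithZero.exp (μ₂ : ℤ) ≤ WithZero.exp (μ₁ : ℤ) := by
    rw [WithZero.exp_le_exp]; exact_mod_cast h
  exact le_trans hf h1

/-- Evaluation codes on the Hermitian curve. -/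
abbrev evalCode {ι : Type*} (Q : Place K (FunctionField K q)) (e : ι → affinePoints K q) (μ : ℕ) :
    Submodule K (ι → K) :=
  (regularSpace Q μ).map (evalLin e)

theorem evalCode_mono {ι : Type*} (e : ι → affinePoints K q) {μ₁ μ₂ : ℕ} (h : μ₂ ≤ μ₁) :
    evalCode Q e μ₂ ≤ evalCode Q e μ₁ :=
  Submodule.map_mono (regularSpace_mono h)

theorem code_eq_evalCode [IsDedekindDomain (CoordinateRing K q)] (hQ : Q.IsPole (funX K q)) {n : ℕ}
    {P : Fin n → Place K (FunctionField K q)} {e : Fin n ≃ affinePoints K q}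
    (he : ∀ i, (P i).IsAt (e i)) (μ : ℕ) : code P Q μ = evalCode Q e μ := by
  ext c
  rw [mem_code hQ he]
  constructor
  · rintro ⟨f, hf, hc⟩
    exact ⟨f, hf, funext hc⟩
  · rintro ⟨f, hf, rfl⟩
    exact ⟨f, hf, fun i => rfl⟩

/-- Words of `C_1 ∩ V_I` lead to functions with distinct pole orders in `(μ₂, μ₁]` that vanish
outside `I`. -/
theorem exists_vanishing_of_relDim {ι : Type*} [Fintype ι] (hQ : Q.IsPole (funX K q))
    (e : ι → affinePoints K q) {μ₁ μ₂ : ℕ} (hμ : μ₂ ≤ μ₁) (I : Finset ι) :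
    ∃ (Γ : Finset ℕ) (F : ℕ → CoordinateRing K q), Γ ⊆ Finset.Ioc μ₂ μ₁ ∧
      Γ.card = relDim (evalCode Q e μ₁) (evalCode Q e μ₂) I ∧
      ∀ γ ∈ Γ, HasPoleOrder Q (F γ) γ ∧ ∀ i, i ∉ I → evalHom (e i) (F γ) = 0 := by
  classical
  let T := regularSpace Q μ₁ ⊓ (supportedOn K I).comap (evalLin e)
  let Γ := (Finset.Ioc μ₂ μ₁).filter fun γ => ∃ f ∈ T, HasPoleOrder Q f γ
  have hch (γ : ℕ) : ∃ f ∈ T, γ ∈ Γ → HasPoleOrder Q f γ := by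
    by_cases h : γ ∈ Γ
    · obtain ⟨f, hf, hfγ⟩ := (Finset.mem_filter.1 h).2
      exact ⟨f, hf, fun _ => hfγ⟩
    · exact ⟨0, T.zero_mem, fun h' => absurd h' h⟩
  choose F hFT hF using hch
  -- An inequality suffices: `Γ` can be cut down to the required size.
  suffices hcard : relDim (evalCode Q e μ₁) (evalCode Q e μ₂) I ≤ Γ.card by
    obtain ⟨Γ', hΓ', hcard'⟩ := Finset.exists_subset_card_eq hcard
    exact ⟨Γ', F, hΓ'.trans (Finset.filter_subset _ _), hcard', fun γ hγ =>
      ⟨hF γ (hΓ' hγ), fun i hi => (hFT γ).2 i hi⟩⟩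
  let S := Submodule.span K (Γ.image F : Set (CoordinateRing K q))
  -- Pole orders above `μ₂` are matched by the chosen F γ; the remaining functions already evaluate
  -- into the smaller code.
  have hT : T ≤ S ⊔ (T ⊓ regularSpace Q μ₂) := by
    refine le_of_hasPoleOrder hQ (sup_le (Submodule.span_le.2 ?_) inf_le_left) fun f hf α hα hfα => ?_
    · intro f hf
      obtain ⟨γ, -, rfl⟩ := Finset.mem_image.1 (Finset.mem_coe.1 hf)
      exact hFT γ
    · have h1 : α ≤ μ₁ := hfα.mem_regularSpace.1 hf.1
      by_cases h2 : α ≤ μ₂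
      · exact ⟨f, Submodule.mem_sup_right ⟨hf, hfα.mem_regularSpace.2 h2⟩, hfα⟩
      · have hγ : α ∈ Γ := Finset.mem_filter.2 ⟨Finset.mem_Ioc.2 ⟨not_le.1 h2, h1⟩, f, hf, hfα⟩
        exact ⟨F α, Submodule.mem_sup_left (Submodule.subset_span (Finset.mem_coe.2
          (Finset.mem_image_of_mem F hγ))), hF α hγ⟩
  have h1 : evalCode Q e μ₁ ⊓ supportedOn K I ≤
      Submodule.span K ((Γ.image F).image (evalLin e) : Finset (ι → K)) ⊔
        (evalCode Q e μ₂ ⊓ supportedOn K I) := by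
    rintro _ ⟨⟨f, hf, rfl⟩, hfI⟩
    have h2 := Submodule.mem_map_of_mem (f := evalLin e) (hT ⟨hf, hfI⟩)
    rw [Submodule.map_sup, Submodule.map_span, ← Finset.coe_image] at h2
    refine (sup_le_sup_left (α := Submodule K (ι → K)) ?_ _) h2
    rintro _ ⟨g, hg, rfl⟩
    exact ⟨⟨g, hg.2, rfl⟩, hg.1.2⟩
  have h2 := (Submodule.finrank_mono h1).trans (Submodule.finrank_add_le_finrank_add_finrank _ _)
  have h3 := finrank_span_finset_le_card (R := K) ((Γ.image F).image (evalLin e))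
  rw [Set.finrank] at h3
  have h4 : ((Γ.image F).image (evalLin e)).card ≤ Γ.card :=
    Finset.card_image_le.trans Finset.card_image_le
  have h5 := relDim_add_finrank (evalCode_mono (Q := Q) e hμ) I
  omega

theorem le_card_of_relDim_eq {ι : Type*} [Fintype ι] (hQ : Q.IsPole (funX K q))
    {e : ι → affinePoints K q} (he : Function.Injective e) {μ₁ μ₂ : ℕ} (hμ : μ₂ < μ₁)
    (hμq : μ₁ - μ₂ ≤ q + 1) {m : ℕ} (hm : 1 ≤ m) {I : Finset ι}
    (hI : relDim (evalCode Q e μ₁) (evalCode Q e μ₂) I = m) :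
    Fintype.card ι + ∑ s ∈ Finset.range (m - 1), (q - s) ≤ I.card + μ₁ := by
  classical
  obtain ⟨Γ, F, hΓ, hcard, hF⟩ := exists_vanishing_of_relDim hQ e hμ.le I
  rw [hI] at hcard
  obtain ⟨g, hg, hmax⟩ := Γ.exists_max_image id (Finset.card_pos.1 (by omega))
  have hH : ∀ γ ∈ Γ, γ ∈ semigroup q := fun γ hγ => by
    obtain ⟨α, hα, h⟩ := exists_hasPoleOrder hQ (hF γ hγ).1.ne_zero
    rwa [(hF γ hγ).1.unique h]
  have hg1 := Finset.mem_Ioc.1 (hΓ hg)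
  -- At most q + 1 integers lie in (μ₂, μ₁], so any two differ by at most q.
  obtain ⟨hfin, hle⟩ := footprint_bound hH hg hmax fun γ hγ => by
    have := Finset.mem_Ioc.1 (hΓ hγ)
    omega
  have h1 := card_common_zeros_le hQ (fun γ hγ => (hF γ hγ).1) hfin (J := Iᶜ.image e) (by
    intro z hz γ hγ
    obtain ⟨i, hi, rfl⟩ := Finset.mem_image.1 hz
    exact (hF γ hγ).2 i (Finset.mem_compl.1 hi))
  rw [Finset.card_image_of_injective _ he, Finset.card_compl] at h1
  rw [hcard] at hle
  omega

end LowerBound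

/-! ### Combinatorics of the staircase of exponents -/

section Staircase

/-- Raising k to k + 1 adds 1 for each u in (k, q], that is, q - k in all. -/
theorem sum_min_eq (q k : ℕ) (hk : k ≤ q) :
    ∑ u ∈ Finset.range (q + 1), min u k = ∑ s ∈ Finset.range k, (q - s) := by
  induction k with
  | zero => simp
  | succ k ih =>
    rw [Finset.sum_range_succ (fun s => q - s) k, ← ih (by omega)]
    have h (u : ℕ) : min u (k + 1) = min u k + if k < u then 1 else 0 := by
      split_ifs <;> omega
    simp_rw [h]
    rw [Finset.sum_add_distrib, Finset.sum_boole]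
    have h1 : (Finset.range (q + 1)).filter (fun u => k < u) = Finset.Ioc k q := by
      ext u; simp; omega
    rw [h1, Nat.card_Ioc, Nat.cast_id]

/-- Exponents of monomials of weights `μ, μ - 1, …, μ - m + 1`, and the part of the staircase below
them: `q` points in each of the first `E` columns and `h u` points in the column `E + u`. -/
theorem exists_staircase {q μ m : ℕ} (hq : 2 ≤ q) (hm : 1 ≤ m) (hmq : m ≤ q + 1)
    (hlow : q * (q - 1) + m ≤ μ + 1) (hup : μ + q * (q - 1) < q ^ 3) :
    ∃ (E D : ℕ) (h : ℕ → ℕ) (z : ℕ → ℕ × ℕ), E + D ≤ q ^ 2 ∧ D ≤ q + 1 ∧ (∀ u, h u ≤ q) ∧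
      (∀ k < m, weight q (z k) + k = μ ∧ E ≤ (z k).1 ∧ ∀ u < D, E + u < (z k).1 ∨ h u ≤ (z k).2) ∧
      μ ≤ q * E + ∑ u ∈ Finset.range D, h u + ∑ s ∈ Finset.range (m - 1), (q - s) := by
  obtain ⟨p, rfl⟩ : ∃ p, q = p + 1 := ⟨q - 1, by omega⟩
  rw [Nat.add_sub_cancel] at hlow hup
  have hj : μ % (p + 1) < p + 1 := Nat.mod_lt _ (by omega)
  have hμ : μ = (μ / (p + 1)) * (p + 1) + μ % (p + 1) := (Nat.div_add_mod' μ (p + 1)).symm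
  generalize μ / (p + 1) = s at hμ
  generalize μ % (p + 1) = j at hμ hj
  subst hμ
  have hs : s ≤ (p + 1) * p := by
    by_contra! hs
    have h1 := Nat.mul_le_mul_right (p + 1) hs
    nlinarith
  have hsq : s + (p + 1) ≤ (p + 1) ^ 2 := by nlinarith
  have hps : p ≤ s := by
    by_contra! hs
    have h1 := Nat.mul_le_mul_right (p + 1) hs
    nlinarith
  -- With μ = sq + j, weights from μ down to sq lie on the antidiagonal of exponent sum s; any
  -- further ones lie on that of sum s - 1.
  by_cases hmj : m ≤ j + 1
  · rcases Nat.eq_zero_or_pos j with rfl | hj0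
    -- Here full columns suffice. Taking D = q + 1 as in the next case could violate E + D ≤ q^2,
    -- where j ≥ 1 is needed.
    · obtain rfl : m = 1 := by omega
      refine ⟨s, 0, fun _ => 0, fun _ => (s, 0), by omega, by omega, by simp, fun k hk => ?_, ?_⟩
      · refine ⟨?_, le_rfl, by simp⟩
        obtain rfl : k = 0 := by omega
        simp [weight_eq]
      · simp [mul_comm]
    · refine ⟨s - j, p + 1 + 1, fun u => j - min u (m - 1), fun k => (s - j + k, j - k), by omega, le_rfl,
        fun u => ?_, fun k hk => ⟨?_, by simp, fun u hu => ?_⟩, ?_⟩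
      · simp only; omega
      · rw [weight_eq, show s - j + k + (j - k) = s by omega]
        omega
      · simp only; omega
      · rw [← sum_min_eq _ _ (by omega), add_assoc, ← Finset.sum_add_distrib]
        have h (u : ℕ) : j - min u (m - 1) + min u (m - 1) = j := Nat.sub_add_cancel (by omega)
        simp only [h, Finset.sum_const, Finset.card_range, smul_eq_mul]
        obtain ⟨t, rfl⟩ := Nat.exists_eq_add_of_le (show j ≤ s by omega)
        rw [Nat.add_sub_cancel_left]
        nlinarith
  · obtain ⟨r, rfl⟩ : ∃ r, m = j + 1 + r := ⟨m - j - 1, by omega⟩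
    have hqs : p + 1 ≤ s := by
      by_contra! hs
      obtain rfl : s = p := by omega
      nlinarith
    obtain ⟨N, hN⟩ := Nat.exists_eq_add_of_le hj.le
    -- The lower antidiagonal starts at column s - q and the upper one at s - j, which is N = q - j
    -- columns later. Before the upper one starts, the r points of the lower antidiagonal cap the
    -- height; from there on the upper one does. The height would be 0 at u = q, so D = q columns
    -- suffice.
    refine ⟨s - (p + 1), p + 1, fun u => if u < N then p + 1 - min (u + 1) r else p + 1 - u,
      fun k => if k ≤ j then (s - j + k, j - k) else (s - (p + 1) + (k - j - 1), p - (k - j - 1)),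
      by omega, by omega, fun u => ?_, fun k hk => ⟨?_, ?_, fun u hu => ?_⟩, ?_⟩
    · simp only; split_ifs <;> omega
    · beta_reduce
      split_ifs with hkj
      · rw [weight_eq, show s - j + k + (j - k) = s by omega]
        omega
      · obtain ⟨t, rfl⟩ := Nat.exists_eq_add_of_le hqs
        rw [weight_eq, show p + 1 + t - (p + 1) + (k - j - 1) + (p - (k - j - 1)) = p + t by omega]
        have : (p + 1 + t) * (p + 1) = (p + t) * (p + 1) + p + 1 := by ring
        omega
    · beta_reduce
      split_ifs <;> simp only <;> omega
    · simp only; split_ifs <;> simp only <;> omega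
    · have h1 : ∑ u ∈ Finset.range (p + 1), (if u < N then p + 1 - min (u + 1) r else p + 1 - u)
          + (∑ u ∈ Finset.range N, min (u + 1) r + ∑ u ∈ Finset.range j, (N + u)) = (p + 1) * (p + 1) := by
        rw [show Finset.range (p + 1) = Finset.range (N + j) by rw [hN, add_comm],
          Finset.sum_range_add, add_add_add_comm, ← Finset.sum_add_distrib, ← Finset.sum_add_distrib]
        have h2 : ∀ u ∈ Finset.range N,
            (if u < N then p + 1 - min (u + 1) r else p + 1 - u) + min (u + 1) r = p + 1 := by
          intro u hu
          rw [if_pos (Finset.mem_range.1 hu)]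
          omega
        have h3 : ∀ u ∈ Finset.range j,
            (if N + u < N then p + 1 - min (N + u + 1) r else p + 1 - (N + u)) + (N + u) = p + 1 := by
          intro u hu
          rw [if_neg (by omega)]
          have := Finset.mem_range.1 hu
          omega
        rw [Finset.sum_congr rfl h2, Finset.sum_congr rfl h3]
        simp only [Finset.sum_const, Finset.card_range, smul_eq_mul]
        rw [← add_mul, add_comm N j, ← hN]
      have h4 : ∑ u ∈ Finset.range N, min (u + 1) r = ∑ u ∈ Finset.range N, min u r + r := by
        have h5 := Finset.sum_range_succ' (fun u => min u r) N
        rw [Finset.sum_range_succ] at h5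
        have h6 : min N r = r := by omega
        simp only [h6, zero_le, inf_of_le_left, add_zero] at h5
        exact h5.symm
      have h7 : ∑ s ∈ Finset.range (j + 1 + r - 1), (p + 1 - s) =
          ∑ u ∈ Finset.range j, (N + u) + ∑ u ∈ Finset.range N, min u r + (j + r) := by
        rw [← sum_min_eq _ _ (by omega), Finset.sum_range_succ]
        congr 1
        · rw [show Finset.range (p + 1) = Finset.range (j + N) by rw [hN], Finset.sum_range_add]
          have h8 : ∀ u ∈ Finset.range j, min u (j + 1 + r - 1) = u := by
            intro u hu
            have := Finset.mem_range.1 hu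
            omega
          have h9 : ∀ u ∈ Finset.range N, min (j + u) (j + 1 + r - 1) = j + min u r := by
            intro u hu
            omega
          rw [Finset.sum_congr rfl h8, Finset.sum_congr rfl h9, Finset.sum_add_distrib,
            Finset.sum_add_distrib]
          simp only [Finset.sum_const, Finset.card_range, smul_eq_mul]
          ring
        · omega
      rw [h7]
      obtain ⟨t, rfl⟩ := Nat.exists_eq_add_of_le hqs
      rw [Nat.add_sub_cancel_left]
      nlinarith

end Staircase

/-! ### Point sets below a staircase and functions vanishing on them -/

section ZeroSets

variable {K : Type*} [Field K] {q : ℕ}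

theorem exists_injOn_of_le_ncard {α : Type*} [Nonempty α] {s : Set α} (hs : s.Finite) {N : ℕ}
    (hN : N ≤ s.ncard) : ∃ f : ℕ → α, Set.InjOn f (Set.Iio N) ∧ ∀ i < N, f i ∈ s := by
  classical
  rw [Set.ncard_eq_toFinset_card s hs] at hN
  obtain ⟨t, ht, hcard⟩ := Finset.exists_subset_card_eq hN
  let e := t.equivFinOfCardEq hcard
  refine ⟨fun i => if h : i < N then e.symm ⟨i, h⟩ else Classical.arbitrary α, ?_, fun i hi => ?_⟩
  · intro i hi j hj h
    simp only [Set.mem_Iio] at hi hj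
    simpa [hi, hj] using h
  · simp only [hi, dif_pos]
    exact hs.mem_toFinset.1 (ht (e.symm ⟨i, hi⟩).2)

/-- A set of affine points shaped like a staircase with respect to suitable `a` and `b`. -/
theorem exists_zero_set (hq : IsPrimePow q) (hK : Nat.card K = q ^ 2) {E D : ℕ} (hED : E + D ≤ q ^ 2)
    (hD : D ≤ q + 1) {h : ℕ → ℕ} (hh : ∀ u, h u ≤ q) :
    ∃ (a b : ℕ → K) (J : Finset (affinePoints K q)),
      J.card = q * E + ∑ u ∈ Finset.range D, h u ∧
      ∀ z ∈ J, (∃ l < E, z.1.1 = a l) ∨ ∃ u < D, ∃ w < h u, z.1.1 = a (E + u) ∧ z.1.2 = b w := by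
  classical
  have hfin := finite_of_natCard_eq_sq hq hK
  -- The last D columns have norm 1, so their fibres are all the trace fibre of 1 and can share the
  -- list `b 1`. The E full columns avoid them.
  obtain ⟨a₁, ha₁, hnorm⟩ := exists_injOn_norm_eq_one (K := K) hq hK
  obtain ⟨a₀, ha₀, ha₀mem⟩ := exists_injOn_of_le_ncard (s := (a₁ '' Set.Iio D)ᶜ) (Set.toFinite _)
    (N := E) (by
      rw [Set.ncard_compl, hK]
      have h1 := Set.ncard_image_le (f := a₁) (Set.finite_Iio D)
      rw [← Finset.coe_range, Set.ncard_coe_finset, Finset.card_range, Finset.coe_range] at h1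
      omega)
  have hb (c : K) : ∃ f : ℕ → K, c ^ q = c → Set.InjOn f (Set.Iio q) ∧
      ∀ w < q, f w ^ q + f w = c := by
    by_cases hc : c ^ q = c
    · obtain ⟨f, hf⟩ := exists_injOn_of_le_ncard (Set.toFinite {b : K | b ^ q + b = c})
        (ncard_trace_fiber hq hK hc).ge
      exact ⟨f, fun _ => hf⟩
    · exact ⟨fun _ => 0, fun h => absurd h hc⟩
  choose b hb using hb
  let a : ℕ → K := fun l => if l < E then a₀ l else a₁ (l - E)
  have haE (u : ℕ) : a (E + u) = a₁ u := by simp [a]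
  have ha : Set.InjOn a (Set.Iio (E + D)) := by
    have hne : ∀ l < E, ∀ u < D, a₀ l ≠ a₁ u := fun l hl u hu h =>
      ha₀mem l hl ⟨u, hu, h.symm⟩
    intro l hl l' hl' hll
    simp only [Set.mem_Iio] at hl hl'
    simp only [a] at hll
    split_ifs at hll with h1 h2 h2
    · exact ha₀ h1 h2 hll
    · exact absurd hll (hne l h1 _ (by omega))
    · exact absurd hll.symm (hne l' h2 _ (by omega))
    · have := ha₁ (show l - E ∈ Set.Iio (q + 1) by simp; omega)
        (show l' - E ∈ Set.Iio (q + 1) by simp; omega) hll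
      omega
  let H : ℕ → ℕ := fun l => if l < E then q else h (l - E)
  have hHq (l : ℕ) : H l ≤ q := by
    simp only [H]; split_ifs
    · exact le_rfl
    · exact hh _
  let S := (Finset.range (E + D)).sigma fun l => Finset.range (H l)
  have hpt (l w : ℕ) (hw : w < q) : (a l, b (a l ^ (q + 1)) w) ∈ affinePoints K q :=
    ((hb _ (norm_pow_of_natCard_eq_sq hq hK (a l))).2 w hw).symm
  let φ : (Σ _ : ℕ, ℕ) → K × K := fun x => (a x.1, b (a x.1 ^ (q + 1)) x.2)
  have hφ : Set.InjOn φ (S : Set (Σ _ : ℕ, ℕ)) := by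
    rintro ⟨l, w⟩ hx ⟨l', w'⟩ hx' hxx
    simp only [S, Finset.coe_sigma, Finset.coe_range, Set.mem_sigma_iff] at hx hx'
    simp only [φ, Prod.mk.injEq] at hxx
    obtain rfl := ha hx.1 hx'.1 hxx.1
    obtain rfl := (hb _ (norm_pow_of_natCard_eq_sq hq hK (a l))).1
      (lt_of_lt_of_le hx.2 (hHq l)) (lt_of_lt_of_le hx'.2 (hHq l)) hxx.2
    rfl
  have hsub : ∀ z ∈ S.image φ, z ∈ affinePoints K q := by
    intro z hz
    obtain ⟨⟨l, w⟩, hx, rfl⟩ := Finset.mem_image.1 hz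
    simp only [S, Finset.mem_sigma, Finset.mem_range] at hx
    exact hpt l w (lt_of_lt_of_le hx.2 (hHq l))
  refine ⟨a, b 1, (S.image φ).subtype (· ∈ affinePoints K q), ?_, fun z hz => ?_⟩
  · rw [Finset.card_subtype, Finset.filter_true_of_mem hsub, Finset.card_image_of_injOn hφ,
      Finset.card_sigma, Finset.sum_range_add]
    congr 1
    · rw [Finset.sum_congr rfl (g := fun _ => q)]
      · simp [mul_comm]
      · intro l hl
        simp [H, Finset.mem_range.1 hl]
    · simp [H]
  · rw [Finset.mem_subtype] at hz
    obtain ⟨⟨l, w⟩, hx, hxz⟩ := Finset.mem_image.1 hz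
    simp only [S, Finset.mem_sigma, Finset.mem_range] at hx
    rw [← hxz]
    by_cases hl : l < E
    · exact Or.inl ⟨l, hl, rfl⟩
    · obtain ⟨u, rfl⟩ := Nat.exists_eq_add_of_le (not_lt.1 hl)
      refine Or.inr ⟨u, by omega, w, by simpa [H] using hx.2, rfl, ?_⟩
      simp only [φ, haE, hnorm]

theorem evalHom_product_eq_zero {a b : ℕ → K} {z : ℕ × ℕ} {x : affinePoints K q}
    (h : (∃ l < z.1, x.1.1 = a l) ∨ ∃ w < z.2, x.1.2 = b w) :
    evalHom x ((∏ l ∈ Finset.range z.1, (coordX K q - algebraMap K _ (a l))) *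
      ∏ w ∈ Finset.range z.2, (coordY K q - algebraMap K _ (b w))) = 0 := by
  rw [map_mul, map_prod, map_prod]
  rcases h with ⟨l, hl, h⟩ | ⟨w, hw, h⟩
  · exact mul_eq_zero_of_left (Finset.prod_eq_zero (Finset.mem_range.2 hl) (by simp [h])) _
  · exact mul_eq_zero_of_right _ (Finset.prod_eq_zero (Finset.mem_range.2 hw) (by simp [h]))

variable [hq : Fact (IsPrimePow q)] {Q : Place K (FunctionField K q)}

theorem HasPoleOrder.sub_algebraMap {f : CoordinateRing K q} {α : ℕ} (hf : HasPoleOrder Q f α)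
    (hα : 0 < α) (a : K) : HasPoleOrder Q (f - algebraMap K _ a) α := by
  have h : Q.v (toFF (algebraMap K (CoordinateRing K q) a)) < Q.v (toFF f) := by
    rw [toFF_algebraMap, hf]
    refine (Q.map_algebraMap_le a).trans_lt ?_
    rw [← WithZero.exp_zero, WithZero.exp_lt_exp]
    exact_mod_cast hα
  rw [HasPoleOrder, toFF, map_sub]
  exact (Valuation.map_sub_eq_of_lt_left _ h).trans hf

theorem HasPoleOrder.prod {f : ℕ → CoordinateRing K q} {α : ℕ} (hf : ∀ l, HasPoleOrder Q (f l) α)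
    (i : ℕ) : HasPoleOrder Q (∏ l ∈ Finset.range i, f l) (α * i) := by
  induction i with
  | zero => simp [HasPoleOrder, toFF]
  | succ i ih =>
    rw [Finset.prod_range_succ, Nat.mul_succ]
    exact ih.mul (hf i)

theorem hasPoleOrder_product (hQ : Q.IsPole (funX K q)) (a b : ℕ → K) (z : ℕ × ℕ) :
    HasPoleOrder Q ((∏ l ∈ Finset.range z.1, (coordX K q - algebraMap K _ (a l))) *
      ∏ w ∈ Finset.range z.2, (coordY K q - algebraMap K _ (b w))) (weight q z) := by
  have hx : HasPoleOrder Q (coordX K q) q := by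
    simpa [monom, weight] using hasPoleOrder_monom hQ (1, 0)
  have hy : HasPoleOrder Q (coordY K q) (q + 1) := by
    simpa [monom, weight] using hasPoleOrder_monom hQ (0, 1)
  exact (HasPoleOrder.prod (fun l => hx.sub_algebraMap hq.out.pos (a l)) z.1).mul
    (HasPoleOrder.prod (fun w => hy.sub_algebraMap (Nat.succ_pos q) (b w)) z.2)

theorem exists_zero_set_of_pole_orders (hQ : Q.IsPole (funX K q)) (hK : Nat.card K = q ^ 2) {μ m : ℕ}
    (hm : 1 ≤ m) (hmq : m ≤ q + 1) (hlow : q * (q - 1) + m ≤ μ + 1) (hup : μ + q * (q - 1) < q ^ 3) :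
    ∃ J : Finset (affinePoints K q), μ ≤ J.card + ∑ s ∈ Finset.range (m - 1), (q - s) ∧
      ∀ k < m, ∃ f : CoordinateRing K q, HasPoleOrder Q f (μ - k) ∧ ∀ x ∈ J, evalHom x f = 0 := by
  obtain ⟨E, D, h, z, hED, hD, hh, hz, hμ⟩ := exists_staircase hq.out.two_le hm hmq hlow hup
  obtain ⟨a, b, J, hJ, hJz⟩ := exists_zero_set hq.out hK hED hD hh
  refine ⟨J, by omega, fun k hk => ?_⟩
  obtain ⟨h1, h2, h3⟩ := hz k hk
  refine ⟨_, (show weight q (z k) = μ - k by omega) ▸ hasPoleOrder_product hQ a b (z k),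
    fun x hx => evalHom_product_eq_zero ?_⟩
  rcases hJz x hx with ⟨l, hl, hxl⟩ | ⟨u, hu, w, hw, hxu, hxw⟩
  · exact Or.inl ⟨l, by omega, hxl⟩
  · rcases h3 u hu with h4 | h4
    · exact Or.inl ⟨_, h4, hxu⟩
    · exact Or.inr ⟨w, by omega, hxw⟩

end ZeroSets

/-! ### Sharpness above the conductor, and the bounds for evaluation codes -/

section UpperBound

variable {K : Type*} [Field K] {q : ℕ} [hq : Fact (IsPrimePow q)]
variable {Q : Place K (FunctionField K q)} {ι : Type*} [Fintype ι] {e : ι → affinePoints K q}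

/-- A function of pole order α has at most α zeros, by the footprint of {α}. -/
theorem HasPoleOrder.evalLin_ne_zero (hQ : Q.IsPole (funX K q)) (he : Function.Injective e)
    {f : CoordinateRing K q} {α : ℕ} (hf : HasPoleOrder Q f α) (hα : α < Fintype.card ι) :
    evalLin e f ≠ 0 := by
  classical
  intro h
  obtain ⟨β, hβ, hfβ⟩ := exists_hasPoleOrder hQ hf.ne_zero
  obtain rfl := hf.unique hfβ
  obtain ⟨hfin, hle⟩ := footprint_singleton hβ
  have h1 := card_common_zeros_le hQ (Γ := {α}) (F := fun _ => f)
    (fun γ hγ => Finset.mem_singleton.1 hγ ▸ hf) hfin (J := Finset.univ.image e) (by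
      intro z hz _ _
      obtain ⟨i, -, rfl⟩ := Finset.mem_image.1 hz
      exact congr_fun h i)
  rw [Finset.card_image_of_injective _ he, Finset.card_univ] at h1
  omega

/-- Lowering the order bound from μ₁ - k to μ₁ - k - 1 loses the word of the k-th function: a word
in both codes would give a nonzero function of order μ₁ - k < n vanishing at all n points. -/
theorem le_relDim (hQ : Q.IsPole (funX K q)) (he : Function.Injective e) {μ₁ μ₂ m : ℕ}
    (hμ : μ₁ < Fintype.card ι) (hm : μ₂ + m ≤ μ₁) {I : Finset ι}
    (h : ∀ k < m, ∃ f : CoordinateRing K q, HasPoleOrder Q f (μ₁ - k) ∧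
      evalLin e f ∈ supportedOn K I) :
    m ≤ relDim (evalCode Q e μ₁) (evalCode Q e μ₂) I := by
  have key : ∀ k ≤ m, Module.finrank K ↥(evalCode Q e (μ₁ - k) ⊓ supportedOn K I) + k ≤
      Module.finrank K ↥(evalCode Q e μ₁ ⊓ supportedOn K I) := by
    intro k
    induction k with
    | zero => simp
    | succ k ih =>
      intro hk
      obtain ⟨f, hf, hfI⟩ := h k (by omega)
      have hlt : evalCode Q e (μ₁ - (k + 1)) ⊓ supportedOn K I <
          evalCode Q e (μ₁ - k) ⊓ supportedOn K I := by
        refine lt_of_le_of_ne (inf_le_inf_right _ (evalCode_mono e (by omega))) fun heq => ?_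
        have h1 : evalLin e f ∈ evalCode Q e (μ₁ - k) ⊓ supportedOn K I :=
          ⟨⟨f, hf.mem_regularSpace.2 le_rfl, rfl⟩, hfI⟩
        rw [← heq] at h1
        obtain ⟨⟨g, hg, hgf⟩, -⟩ := h1
        have h2 : Q.v (toFF g) < Q.v (toFF f) := by
          rw [hf]
          refine lt_of_le_of_lt hg ?_
          rw [WithZero.exp_lt_exp]
          omega
        have h3 : HasPoleOrder Q (f - g) (μ₁ - k) := by
          rw [HasPoleOrder, toFF, map_sub]
          exact (Valuation.map_sub_eq_of_lt_left _ h2).trans hf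
        refine h3.evalLin_ne_zero hQ he (by omega) ?_
        rw [map_sub, hgf, sub_self]
      have h4 := Submodule.finrank_lt_finrank_of_lt hlt
      have h5 := ih (by omega)
      omega
  have h1 := key m le_rfl
  have h2 := relDim_add_finrank (evalCode_mono (Q := Q) e (show μ₂ ≤ μ₁ by omega)) I
  have h3 : Module.finrank K ↥(evalCode Q e μ₂ ⊓ supportedOn K I) ≤
      Module.finrank K ↥(evalCode Q e (μ₁ - m) ⊓ supportedOn K I) :=
    Submodule.finrank_mono (inf_le_inf_right _ (evalCode_mono e (by omega)))
  omega

theorem finrank_evalCode_sub_le (hQ : Q.IsPole (funX K q)) {μ₁ μ₂ : ℕ} (hμ : μ₂ ≤ μ₁) :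
    Module.finrank K (evalCode Q e μ₁) - Module.finrank K (evalCode Q e μ₂) ≤ μ₁ - μ₂ := by
  obtain ⟨Γ, F, hΓ, hcard, -⟩ := exists_vanishing_of_relDim hQ e hμ Finset.univ
  rw [← relDim_univ (evalCode_mono e hμ), ← hcard, ← Nat.card_Ioc]
  exact Finset.card_le_card hΓ

theorem finrank_evalCode_sub (hQ : Q.IsPole (funX K q)) (he : Function.Injective e) {μ₁ μ₂ : ℕ}
    (hμ : μ₂ ≤ μ₁) (hμ₁ : μ₁ < Fintype.card ι) (hlow : q * (q - 1) ≤ μ₂ + 1) :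
    Module.finrank K (evalCode Q e μ₁) - Module.finrank K (evalCode Q e μ₂) = μ₁ - μ₂ := by
  refine le_antisymm (finrank_evalCode_sub_le hQ hμ) ?_
  rw [← relDim_univ (evalCode_mono e hμ)]
  refine le_relDim hQ he hμ₁ (by omega) fun k hk => ?_
  -- From q(q-1) on, every integer is a pole order, and μ₁ - k ≥ μ₂ + 1.
  obtain ⟨z, hz⟩ := mem_semigroup_of_le hq.out.pos (show q * (q - 1) ≤ μ₁ - k by omega)
  exact ⟨monom K q z, hz ▸ hasPoleOrder_monom hQ z, by rw [supportedOn_univ]; trivial⟩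

theorem rghw_evalCode_le (hQ : Q.IsPole (funX K q)) (hK : Nat.card K = q ^ 2)
    (he : Function.Bijective e) (hn : Fintype.card ι = q ^ 3) {μ₁ μ₂ : ℕ}
    (hμq : μ₁ - μ₂ ≤ q + 1) (hlow : q * (q - 1) ≤ μ₂ + 1) (hup : μ₁ + q * (q - 1) < q ^ 3) {m : ℕ}
    (hm : 1 ≤ m) (hmμ : μ₂ + m ≤ μ₁) :
    rghw (evalCode Q e μ₁) (evalCode Q e μ₂) m + μ₁ ≤
      q ^ 3 + ∑ s ∈ Finset.range (m - 1), (q - s) := by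
  classical
  obtain ⟨J, hJ, hf⟩ := exists_zero_set_of_pole_orders hQ hK (μ := μ₁) hm (by omega) (by omega) hup
  -- The support is the complement of the common zero set.
  let I := Finset.univ.filter fun i => e i ∉ J
  have hI : I.card + J.card = q ^ 3 := by
    have h1 : J.card = (Finset.univ.filter fun i => e i ∈ J).card := by
      rw [← Finset.card_image_of_injective _ he.1]
      congr 1
      ext z
      obtain ⟨i, rfl⟩ := he.2 z
      simp [he.1.eq_iff]
    rw [h1, ← hn, ← Finset.card_univ, add_comm]
    exact Finset.card_filter_add_card_filter_not _
  have h2 : m ≤ relDim (evalCode Q e μ₁) (evalCode Q e μ₂) I := by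
    refine le_relDim hQ he.1 (by omega) hmμ fun k hk => ?_
    obtain ⟨f, hf, hfJ⟩ := hf k hk
    refine ⟨f, hf, fun i hi => hfJ _ ?_⟩
    simpa [I] using hi
  have h3 := rghw_le (evalCode_mono (Q := Q) e (show μ₂ ≤ μ₁ by omega)) h2
  omega

theorem le_rghw_evalCode (hQ : Q.IsPole (funX K q)) (he : Function.Injective e) {μ₁ μ₂ : ℕ}
    (hμ : μ₂ < μ₁) (hμq : μ₁ - μ₂ ≤ q + 1) {m : ℕ} (hm : 1 ≤ m)
    (hm' : m ≤ Module.finrank K (evalCode Q e μ₁) - Module.finrank K (evalCode Q e μ₂)) :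
    Fintype.card ι + ∑ s ∈ Finset.range (m - 1), (q - s) ≤
      rghw (evalCode Q e μ₁) (evalCode Q e μ₂) m + μ₁ := by
  have h := le_rghw (B := Fintype.card ι + ∑ s ∈ Finset.range (m - 1), (q - s) - μ₁)
    (evalCode_mono e hμ.le) hm' fun I hI => by
      have := le_card_of_relDim_eq hQ he hμ hμq hm hI
      omega
  omega

end UpperBound

/-! ### The closed form of the sum, and integer casts -/

theorem sum_range_sub_eq (q m : ℕ) (hm : 1 ≤ m) :
    ∑ s ∈ Finset.range (m - 1), ((q : ℤ) - s) =
      q * ((m : ℤ) - 1) - ((m : ℤ) - 2) * ((m : ℤ) - 1) / 2 := by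
  obtain ⟨k, rfl⟩ := Nat.exists_eq_add_of_le' hm
  rw [Nat.add_sub_cancel]
  -- Doubling avoids the floor in the integer division, which is then seen to be exact.
  have h : 2 * ∑ s ∈ Finset.range k, ((q : ℤ) - s) = 2 * (q * k) - (k - 1) * k := by
    induction k with
    | zero => simp
    | succ k ih =>
      rw [Finset.sum_range_succ, mul_add, ih (by omega)]
      push_cast
      ring
  push_cast
  have h1 : ((k : ℤ) + 1 - 2) * (k + 1 - 1) = (k - 1) * k := by ring
  have h2 : (q : ℤ) * (k + 1 - 1) = q * k := by ring
  rw [h1, h2]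
  omega

theorem cast_sum_range_sub {q k : ℕ} (h : k ≤ q + 1) :
    ((∑ s ∈ Finset.range k, (q - s) : ℕ) : ℤ) = ∑ s ∈ Finset.range k, ((q : ℤ) - s) := by
  rw [Nat.cast_sum]
  refine Finset.sum_congr rfl fun s hs => ?_
  rw [Nat.cast_sub (by have := Finset.mem_range.1 hs; omega)]

end Hermitian

end

theorem mainTheorem1 (q : ℕ) [Fact (IsPrimePow q)]
    (K : Type*) [Field K] (hK : Nat.card K = q ^ 2)
    (Q : Hermitian.Place K (Hermitian.FunctionField K q))
    (hQ : Q.IsPole (Hermitian.funX K q))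
    (n : ℕ) (P : Fin n → Hermitian.Place K (Hermitian.FunctionField K q))
    (hP : Function.Injective P)
    (hPrange : Set.range P = {R | R.IsRational ∧ R ≠ Q})
    (μ₁ μ₂ : ℕ) (hμ : μ₂ < μ₁) (hμq : μ₁ - μ₂ ≤ q + 1) :
    n = q ^ 3 ∧
    (∀ m : ℕ, 1 ≤ m →
      m ≤ Module.finrank K (Hermitian.code P Q μ₁) - Module.finrank K (Hermitian.code P Q μ₂) →
      (Hermitian.rghw (Hermitian.code P Q μ₁) (Hermitian.code P Q μ₂) m : ℤ) ≥
          (n : ℤ) - μ₁ + ∑ s ∈ Finset.range (m - 1), ((q : ℤ) - s) ∧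
      (n : ℤ) - μ₁ + ∑ s ∈ Finset.range (m - 1), ((q : ℤ) - s) =
          (n : ℤ) - μ₁ + q * ((m : ℤ) - 1) - ((m : ℤ) - 2) * ((m : ℤ) - 1) / 2) ∧
    ((q : ℤ) * ((q : ℤ) - 1) - 1 ≤ μ₂ → (μ₁ : ℤ) < (n : ℤ) - (q : ℤ) * ((q : ℤ) - 1) →
      (Module.finrank K (Hermitian.code P Q μ₁) : ℤ) - Module.finrank K (Hermitian.code P Q μ₂) =
          (μ₁ : ℤ) - μ₂ ∧
      ∀ m : ℕ, 1 ≤ m →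
        m ≤ Module.finrank K (Hermitian.code P Q μ₁) -
          Module.finrank K (Hermitian.code P Q μ₂) →
        (Hermitian.rghw (Hermitian.code P Q μ₁) (Hermitian.code P Q μ₂) m : ℤ) =
          (n : ℤ) - μ₁ + ∑ s ∈ Finset.range (m - 1), ((q : ℤ) - s)) := by
  have hq : IsPrimePow q := Fact.out
  have := Hermitian.isDedekindDomain_coordinateRing (K := K) (q := q)
    (Hermitian.natCast_eq_zero_of_natCard_eq_sq hq hK)
  obtain ⟨e, he⟩ := Hermitian.exists_equiv_affinePoints hQ hP hPrange
  have hn : n = q ^ 3 := by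
    rw [← Hermitian.ncard_affinePoints (K := K) hq hK, ← Nat.card_coe_set_eq, ← Nat.card_congr e,
      Nat.card_eq_fintype_card, Fintype.card_fin]
  have hle := Hermitian.finrank_evalCode_sub_le (e := e) hQ hμ.le
  rw [Hermitian.code_eq_evalCode hQ he, Hermitian.code_eq_evalCode hQ he]
  have hlower (m : ℕ) (hm : 1 ≤ m) (hm' : m ≤ Module.finrank K (Hermitian.evalCode Q e μ₁) -
      Module.finrank K (Hermitian.evalCode Q e μ₂)) :
      (n : ℤ) - μ₁ + ∑ s ∈ Finset.range (m - 1), ((q : ℤ) - s) ≤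
        Hermitian.rghw (Hermitian.evalCode Q e μ₁) (Hermitian.evalCode Q e μ₂) m := by
    have h := Hermitian.le_rghw_evalCode hQ e.injective hμ hμq hm hm'
    rw [Fintype.card_fin] at h
    -- By `hle`, m ≤ μ₁ - μ₂ ≤ q + 1, so no difference q - s is truncated.
    rw [← Hermitian.cast_sum_range_sub (by omega)]
    omega
  refine ⟨hn, fun m hm hm' => ⟨hlower m hm hm', ?_⟩, fun hlow hup => ?_⟩
  · rw [Hermitian.sum_range_sub_eq q m hm, add_sub_assoc]
  have hcast : ((q * (q - 1) : ℕ) : ℤ) = (q : ℤ) * ((q : ℤ) - 1) := by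
    rw [Nat.cast_mul, Nat.cast_sub hq.pos, Nat.cast_one]
  rw [← hcast] at hlow hup
  have hdim := Hermitian.finrank_evalCode_sub hQ e.injective hμ.le
    (by rw [Fintype.card_fin]; omega) (show q * (q - 1) ≤ μ₂ + 1 by omega)
  refine ⟨by omega, fun m hm hm' => le_antisymm ?_ (hlower m hm hm')⟩
  have h := Hermitian.rghw_evalCode_le hQ hK e.bijective (by rw [Fintype.card_fin, hn]) hμq
    (show q * (q - 1) ≤ μ₂ + 1 by omega) (by omega) hm (show μ₂ + m ≤ μ₁ by omega)
  rw [← Hermitian.cast_sum_range_sub (by omega)]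
  omega
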